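/- Let $N$ be a closed smooth manifold of dimension $2n+1$ and let $p:N\to S^1$ be a smooth fibration (surjective submersion) whose fibers are oriented Riemannian manifolds of dimension $2n$ with metrics depending smoothly on the fiber, and let a spin structure be given on the vertical tangent bundle $T(N/S^1)=\ker dp$. Fix a connection in the fibration, i.e. a smooth horizontal distribution in $TN$ complementary to $\ker dp$, and write $\tilde Y$ for the horizontal lift to $N$ of a vector field $Y$ on $S^1$. Let $g$ be the symmetric 2-tensor on $N$ equal to the fiber metrics on vertical vectors and vanishing on horizontal vectors, let $g^M$ be a Riemannian metric on $S^1$, and let $\partial_\theta$ be a smooth vector field on $S^1$ of unit length for $g^M$. Let $S=S^+\oplus S^-$ be the complex spinor bundle of the fibers, where $S^\pm$ is the $\pm1$-eigenbundle of $i^n c(e_1)\cdots c(e_{2n})$ for an oriented orthonormal vertical frame $(e_1,\dots,e_{2n})$. Here Clifford multiplication satisfies $c(v)^2=-|v|^2$ and is skew-adjoint for the Hermitian metric of $S$. Let $D:C^\infty(N,S^+)\to C^\infty(N,S^-)$ be the family of chiral Dirac operators of the fibers. Let $\nabla$ be the connection on $S$ induced by the vertical projection of the Levi-Civita connection of $g+p^*g^M$,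 and put $$\tilde\nabla_Y=\nabla_{\tilde Y}+\tfrac14\,\mathrm{tr}(L_{\tilde Y}g),$$ where $\mathrm{tr}$ is the contraction by $g$ and $L$ is the Lie derivative. For $t>0$ give $N$ the metric $g_t^N=g+t^{-2}p^*g^M$ and the spin structure induced by that of the fibers and the trivial (non-bounding) spin structure of $S^1$. The spinor bundle of $N$ is then $S^+\oplus S^-$, where the unit vector $t\tilde\partial_\theta$ acts by Clifford multiplication as $\mp i$ on $S^\pm$. Let $\delta_t$ be the Dirac operator of $(N,g_t^N)$. Then $D$ has a formal adjoint $D^*:C^\infty(N,S^-)\to C^\infty(N,S^+)$, with respect to the Hermitian metric on $S$ and the Riemannian volume of $g_t^N$, such that on smooth sections, in the splitting $S=S^+\oplus S^-$, $$\delta_t=\begin{pmatrix}-ti\tilde\nabla_{\partial_\theta}&D^*\\ D&ti\tilde\nabla_{\partial_\theta}\end{pmatrix}.$$ -/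

import Mathlib

open scoped Manifold ContDiff

universe u v w

noncomputable section

namespace AdiabaticDirac

/-! ### Clifford algebras and spinor modules -/

/-- The negative definite quadratic form `v ↦ -|v|²` on `ℝ^d`; with it, Clifford multiplication
by a unit vector squares to `-1`. -/
abbrev negQ (d : ℕ) : QuadraticForm ℝ (Fin d → ℝ) :=
  QuadraticMap.weightedSumSquares ℝ (fun _ : Fin d => (-1 : ℝ))

/-- The real Clifford algebra of `ℝ^d`. The group `Spin(d)` is `spinGroup (negQ d)`. -/
abbrev Cl (d : ℕ) : Type := CliffordAlgebra (negQ d)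

/-- A vector of `ℝ^d` as an element of the Clifford algebra. -/
def vec {d : ℕ} (v : Fin d → ℝ) : Cl d := CliffordAlgebra.ι (negQ d) v

/-- The `k`-th standard basis vector, as an element of the Clifford algebra. -/
def gam {d : ℕ} (k : Fin d) : Cl d := vec (Pi.single k 1)

theorem negQ_apply {d : ℕ} (v : Fin d → ℝ) : negQ d v = -∑ k, v k * v k := by
  simp [negQ, QuadraticMap.weightedSumSquares_apply]

theorem vec_sq {d : ℕ} (v : Fin d → ℝ) :
    vec v * vec v = algebraMap ℝ (Cl d) (-∑ k, v k * v k) := by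
  rw [← negQ_apply]; exact CliffordAlgebra.ι_sq_scalar _ v

theorem gam_sq {d : ℕ} (k : Fin d) : gam k * gam k = -1 := by
  simp [gam, vec_sq, Pi.single_apply]

theorem gam_anticomm {d : ℕ} {k l : Fin d} (h : k ≠ l) : gam k * gam l = -(gam l * gam k) := by
  have h1 : (gam k + gam l) * (gam k + gam l) = algebraMap ℝ (Cl d) (-2) := by
    have : gam k + gam l = vec (Pi.single k 1 + Pi.single l 1 : Fin d → ℝ) := by
      simp [gam, vec]
    rw [this, vec_sq]
    congr 2
    simp only [Pi.add_apply, add_mul, mul_add, Finset.sum_add_distrib, Pi.single_apply]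
    simp [h, h.symm]
    norm_num
  have h2 : (gam k + gam l) * (gam k + gam l)
      = gam k * gam k + gam l * gam l + (gam k * gam l + gam l * gam k) := by noncomm_ring
  rw [h2, gam_sq, gam_sq] at h1
  have h3 : algebraMap ℝ (Cl d) (-2) = -1 + -1 := by
    rw [show (-2 : ℝ) = -1 + -1 by norm_num, map_add, map_neg, map_one]
  rw [h3] at h1
  exact eq_neg_of_add_eq_zero_left (by simpa using h1)

/-- The product `e₁ e₂ ⋯ e_d` in the Clifford algebra. -/
def volElt (d : ℕ) : Cl d := (List.ofFn fun k : Fin d => gam k).prod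

theorem gam_mul_prod {d : ℕ} (k : Fin d) (L : List (Fin d)) (h : k ∉ L) :
    gam k * (L.map gam).prod = (-1) ^ L.length * ((L.map gam).prod * gam k) := by
  induction L with
  | nil => simp
  | cons a L ih =>
    have hk : k ≠ a := fun e => h (by simp [e])
    have hL : k ∉ L := fun e => h (by simp [e])
    have hc : gam a * (-1 : Cl d) ^ L.length = (-1) ^ L.length * gam a :=
      ((Commute.neg_one_right _).pow_right _).eq
    simp only [List.map_cons, List.prod_cons, List.length_cons]
    rw [← mul_assoc, gam_anticomm hk, neg_mul, mul_assoc, ih hL, ← mul_assoc (gam a), hc, pow_succ]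
    noncomm_ring

theorem gam_mul_prod_mem {d : ℕ} (k : Fin d) (L : List (Fin d)) (hn : L.Nodup) (h : k ∈ L) :
    gam k * (L.map gam).prod = (-1) ^ (L.length + 1) * ((L.map gam).prod * gam k) := by
  induction L with
  | nil => simp at h
  | cons a L ih =>
    have hc : gam a * (-1 : Cl d) ^ L.length = (-1) ^ L.length * gam a :=
      ((Commute.neg_one_right _).pow_right _).eq
    obtain ⟨ha, hn'⟩ := List.nodup_cons.1 hn
    simp only [List.map_cons, List.prod_cons, List.length_cons]
    by_cases hk : k = a
    · subst hk
      have hp := gam_mul_prod k L ha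
      have e2 : ((-1 : Cl d)) ^ L.length * (-1) ^ L.length = 1 := by
        rw [← pow_add, ← two_mul, pow_mul]; simp
      have hp' : (L.map gam).prod * gam k = (-1) ^ L.length * (gam k * (L.map gam).prod) := by
        rw [hp, ← mul_assoc, e2, one_mul]
      rw [mul_assoc (gam k) _ (gam k), hp', ← mul_assoc (gam k) ((-1) ^ L.length), hc, pow_succ,
        pow_succ, mul_assoc ((-1) ^ L.length) (gam k), ← mul_assoc, ← mul_assoc]
      have : (-1 : Cl d) ^ L.length * -1 * -1 * (-1) ^ L.length = 1 := by
        rw [mul_assoc ((-1 : Cl d) ^ L.length)]; simpa using e2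
      rw [this, one_mul, mul_assoc]
    · have hL : k ∈ L := by simpa [hk] using h
      rw [← mul_assoc, gam_anticomm hk, neg_mul, mul_assoc, ih hn' hL, pow_succ, ← mul_assoc (gam a),
        ← mul_assoc (gam a), hc, pow_succ, pow_succ]
      noncomm_ring

theorem prod_sq_aux {d : ℕ} (L : List (Fin d)) (hn : L.Nodup) :
    (L.map gam).prod * (L.map gam).prod
      = (-1 : Cl d) ^ (∑ i ∈ Finset.range (L.length + 1), i) := by
  induction L with
  | nil => simp
  | cons a L ih =>
    obtain ⟨ha, hn'⟩ := List.nodup_cons.1 hn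
    have hp := gam_mul_prod a L ha
    have e2 : ((-1 : Cl d)) ^ L.length * (-1) ^ L.length = 1 := by
      rw [← pow_add, ← two_mul, pow_mul]; simp
    have hp' : (L.map gam).prod * gam a = (-1) ^ L.length * (gam a * (L.map gam).prod) := by
      rw [hp, ← mul_assoc, e2, one_mul]
    have hc : gam a * (-1 : Cl d) ^ L.length = (-1) ^ L.length * gam a :=
      ((Commute.neg_one_right _).pow_right _).eq
    simp only [List.map_cons, List.prod_cons, List.length_cons]
    calc gam a * (L.map gam).prod * (gam a * (L.map gam).prod)
        = gam a * ((L.map gam).prod * gam a) * (L.map gam).prod := by noncomm_ring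
      _ = (-1) ^ L.length * (gam a * gam a) * ((L.map gam).prod * (L.map gam).prod) := by
          rw [hp', ← mul_assoc, hc]; noncomm_ring
      _ = _ := by
          rw [ih hn', gam_sq, Finset.sum_range_succ _ (L.length + 1), ← pow_succ, ← pow_add,
            add_comm]

theorem volElt_eq (d : ℕ) : volElt d = ((List.finRange d).map gam).prod := by
  rw [volElt, List.ofFn_eq_map]

theorem gam_mul_volElt (n : ℕ) (k : Fin (2 * n)) :
    gam k * volElt (2 * n) = -(volElt (2 * n) * gam k) := by
  rw [volElt_eq, gam_mul_prod_mem k _ (List.nodup_finRange _) (List.mem_finRange k),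
    List.length_finRange, pow_succ, pow_mul]
  simp

theorem volElt_sq (n : ℕ) : volElt (2 * n) * volElt (2 * n) = (-1) ^ n := by
  rw [volElt_eq, prod_sq_aux _ (List.nodup_finRange _), List.length_finRange]
  have : (∑ i ∈ Finset.range (2 * n + 1), i) = n * (2 * n + 1) := by
    have := Finset.sum_range_id_mul_two (2 * n + 1)
    simp only [Nat.add_sub_cancel] at this
    nlinarith
  rw [this, show n * (2 * n + 1) = 2 * (n * n) + n by ring, pow_add, pow_mul]
  simp

/-! The inclusion of Clifford algebras and spin groups induced by `ℝ^d = ℝ^d × 0 ⊆ ℝ^(d+1)`. -/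

/-- The linear isometric inclusion `ℝ^d → ℝ^(d+1)`, `v ↦ (v, 0)`. -/
def inclIsom (d : ℕ) : negQ d →qᵢ negQ (d + 1) where
  toFun v := Fin.snoc (α := fun _ => ℝ) v 0
  map_add' v w := by
    funext i; refine Fin.lastCases ?_ (fun j => ?_) i <;> simp
  map_smul' c v := by
    funext i; refine Fin.lastCases ?_ (fun j => ?_) i <;> simp
  map_app' v := by
    rw [negQ_apply, negQ_apply, Fin.sum_univ_castSucc]
    simp

/-- The induced inclusion `Cl(d) → Cl(d+1)`, which restricts to `Spin(d) → Spin(d+1)`. -/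
def clIncl (d : ℕ) : Cl d →ₐ[ℝ] Cl (d + 1) := CliffordAlgebra.map (inclIsom d)

theorem clIncl_vec {d : ℕ} (v : Fin d → ℝ) :
    clIncl d (vec v) = vec (Fin.snoc (α := fun _ => ℝ) v 0) :=
  CliffordAlgebra.map_apply_ι _ _

theorem clIncl_gam {d : ℕ} (k : Fin d) : clIncl d (gam k) = gam k.castSucc := by
  rw [gam, clIncl_vec, gam]
  congr 1
  funext i
  refine Fin.lastCases ?_ (fun j => ?_) i
  · simp [(Fin.castSucc_lt_last k).ne']
  · simp [Pi.single_apply]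

theorem clIncl_star {d : ℕ} (x : Cl d) : clIncl d (star x) = star (clIncl d x) := by
  induction x using CliffordAlgebra.induction with
  | algebraMap r => simp [CliffordAlgebra.star_algebraMap]
  | ι v =>
    have := clIncl_vec v
    simp only [vec] at this
    rw [CliffordAlgebra.star_ι, map_neg, this, CliffordAlgebra.star_ι]
  | mul a b ha hb => rw [star_mul, map_mul, map_mul, star_mul, ha, hb]
  | add a b ha hb => rw [star_add, map_add, map_add, star_add, ha, hb]

theorem clIncl_even {d : ℕ} {x : Cl d} (hx : x ∈ CliffordAlgebra.evenOdd (negQ d) 0) :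
    clIncl d x ∈ CliffordAlgebra.evenOdd (negQ (d + 1)) 0 := by
  induction x, hx using CliffordAlgebra.even_induction with
  | algebraMap r =>
    rw [AlgHom.commutes]
    exact (CliffordAlgebra.even (negQ (d + 1))).algebraMap_mem r
  | add x y _ _ hx hy => rw [map_add]; exact add_mem hx hy
  | ι_mul_ι_mul a b x _ hx =>
    have ha := clIncl_vec a
    have hb := clIncl_vec b
    simp only [vec] at ha hb
    rw [map_mul, map_mul, ha, hb]
    exact (CliffordAlgebra.even (negQ (d + 1))).mul_mem
      (CliffordAlgebra.ι_mul_ι_mem_evenOdd_zero _ _ _) hx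

theorem clIncl_spin {d : ℕ} {x : Cl d} (hx : x ∈ spinGroup (negQ d)) :
    clIncl d x ∈ spinGroup (negQ (d + 1)) := by
  refine spinGroup.mem_iff.2 ⟨pinGroup.mem_iff.2 ⟨?_, ?_⟩, ?_⟩
  · obtain ⟨y, hy, rfl⟩ := (pinGroup.mem_iff.1 (spinGroup.mem_pin hx)).1
    refine ⟨Units.map (clIncl d : Cl d →* Cl (d + 1)) y, ?_, rfl⟩
    have : (lipschitzGroup (negQ d)).map (Units.map (clIncl d : Cl d →* Cl (d + 1)))
        ≤ lipschitzGroup (negQ (d + 1)) := by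
      rw [lipschitzGroup, MonoidHom.map_closure, Subgroup.closure_le]
      rintro _ ⟨z, ⟨v, hv⟩, rfl⟩
      refine Subgroup.subset_closure ⟨Fin.snoc (α := fun _ => ℝ) v 0, ?_⟩
      have := clIncl_vec v
      simp only [vec] at this
      rw [← this, hv]
      rfl
    exact this ⟨y, hy, rfl⟩
  · have h1 := spinGroup.star_mul_self_of_mem hx
    have h2 := spinGroup.mul_star_self_of_mem hx
    refine Unitary.mem_iff.2 ⟨?_, ?_⟩
    · rw [← clIncl_star, ← map_mul, h1, map_one]
    · rw [← clIncl_star, ← map_mul, h2, map_one]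
  · exact clIncl_even (spinGroup.mem_even hx)

theorem clIncl_mul_last {d : ℕ} (x : Cl d) :
    clIncl d x * gam (Fin.last d) = gam (Fin.last d) * clIncl d (CliffordAlgebra.involute x) := by
  induction x using CliffordAlgebra.induction with
  | algebraMap r => simp [Algebra.commutes]
  | ι v =>
    rw [CliffordAlgebra.involute_ι, map_neg, mul_neg]
    have hv : (CliffordAlgebra.ι (negQ d) v) = ∑ k, v k • gam k := by
      conv_lhs => rw [← (Pi.basisFun ℝ (Fin d)).sum_repr v]
      simp [gam, vec]
    rw [hv]
    simp only [map_sum, map_smul, clIncl_gam, Finset.sum_mul, Finset.mul_sum]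
    rw [← Finset.sum_neg_distrib]
    refine Finset.sum_congr rfl fun k _ => ?_
    rw [smul_mul_assoc, gam_anticomm (Fin.castSucc_lt_last k).ne, mul_smul_comm, smul_neg]
  | mul a b ha hb => rw [map_mul, mul_assoc, hb, ← mul_assoc, ha, mul_assoc, map_mul, map_mul]
  | add a b ha hb => rw [map_add, add_mul, ha, hb, map_add, map_add, mul_add]

theorem clIncl_conj_last {d : ℕ} {x : Cl d} (hx : x ∈ spinGroup (negQ d)) :
    clIncl d x * gam (Fin.last d) * star (clIncl d x) = gam (Fin.last d) := by
  rw [clIncl_mul_last, spinGroup.involute_eq hx, mul_assoc, ← clIncl_star, ← map_mul,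
    spinGroup.mul_star_self_of_mem hx, map_one, mul_one]

/-- A complex spinor module of `ℝ^(2n)` with its Hermitian metric: a complex representation of the
Clifford algebra `Cl(2n)` of the least possible dimension `2^n` (it is irreducible, and unique up
to isomorphism), on which vectors act by skew-adjoint operators. -/
structure SpinorModule (n : ℕ) (Sg : Type v) [NormedAddCommGroup Sg] [InnerProductSpace ℂ Sg] where
  rho : Cl (2 * n) →ₐ[ℝ] Module.End ℂ Sg
  skew : ∀ (w : Fin (2 * n) → ℝ) (x y : Sg),
    inner ℂ (rho (vec w) x) y = -inner ℂ x (rho (vec w) y)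
  finrank_eq : Module.finrank ℂ Sg = 2 ^ n

namespace SpinorModule

variable {n : ℕ} {Sg : Type v} [NormedAddCommGroup Sg] [InnerProductSpace ℂ Sg]

/-- The chirality operator `i^n c(e₁) ⋯ c(e_{2n})`, an involution; its `±1`-eigenspaces are the
half-spinor modules `Σ^±`. -/
def chir (R : SpinorModule n Sg) : Module.End ℂ Sg := Complex.I ^ n • R.rho (volElt (2 * n))

/-- The projection `Σ → Σ^+`. -/
def projPlus (R : SpinorModule n Sg) (s : Sg) : Sg := (1 / 2 : ℂ) • (s + R.chir s)

/-- The projection `Σ → Σ^-`. -/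
def projMinus (R : SpinorModule n Sg) (s : Sg) : Sg := (1 / 2 : ℂ) • (s - R.chir s)

theorem chir_sq (R : SpinorModule n Sg) : R.chir * R.chir = 1 := by
  rw [chir, smul_mul_smul_comm, ← map_mul, volElt_sq, ← mul_pow, Complex.I_mul_I, map_pow, map_neg,
    map_one]
  rcases Nat.even_or_odd n with h | h <;> simp [h.neg_one_pow]

theorem rho_chir (R : SpinorModule n Sg) (w : Fin (2 * n) → ℝ) :
    R.rho (vec w) * R.chir = -(R.chir * R.rho (vec w)) := by
  have hv : (vec w : Cl (2 * n)) = ∑ k, w k • gam k := by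
    conv_lhs => rw [← (Pi.basisFun ℝ (Fin (2 * n))).sum_repr w]
    simp [gam, vec]
  have key : vec w * volElt (2 * n) = -(volElt (2 * n) * vec w) := by
    rw [hv, Finset.sum_mul, Finset.mul_sum, ← Finset.sum_neg_distrib]
    refine Finset.sum_congr rfl fun k _ => ?_
    rw [smul_mul_assoc, gam_mul_volElt, mul_smul_comm, smul_neg]
  rw [chir, mul_smul_comm, smul_mul_assoc, ← map_mul, ← map_mul, key, map_neg, smul_neg]

/-- Clifford multiplication by a vector of `ℝ^(2n+1)` on `Σ`: the first `2n` coordinates act as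
in `ℝ^(2n)`, and the last basis vector acts as `-i` on `Σ^+` and as `i` on `Σ^-`. -/
def oddVec (R : SpinorModule n Sg) : (Fin (2 * n + 1) → ℝ) →ₗ[ℝ] Module.End ℂ Sg where
  toFun w := R.rho (vec (fun k => w k.castSucc)) + w (Fin.last _) • (-Complex.I • R.chir)
  map_add' w w' := by
    have : (fun k : Fin (2 * n) => (w + w') k.castSucc)
      = (fun k => w k.castSucc) + (fun k => w' k.castSucc) := rfl
    rw [this, vec, map_add, map_add, Pi.add_apply, add_smul]
    simp only [vec]
    abel
  map_smul' c w := by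
    have : (fun k : Fin (2 * n) => (c • w) k.castSucc) = c • (fun k => w k.castSucc) := rfl
    rw [this, vec, map_smul, map_smul, Pi.smul_apply, smul_eq_mul, mul_smul, RingHom.id_apply,
      smul_add]
    rfl

theorem oddVec_sq (R : SpinorModule n Sg) (w : Fin (2 * n + 1) → ℝ) :
    R.oddVec w * R.oddVec w = algebraMap ℝ _ (negQ (2 * n + 1) w) := by
  have h1 : R.rho (vec (fun k => w k.castSucc)) * R.rho (vec (fun k => w k.castSucc))
      = algebraMap ℝ _ (-∑ k : Fin (2 * n), w k.castSucc * w k.castSucc) := by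
    rw [← map_mul, vec_sq, AlgHom.commutes]
  have h2 := R.rho_chir (fun k => w k.castSucc)
  have h3 : (-Complex.I • R.chir) * (-Complex.I • R.chir) = -1 := by
    rw [smul_mul_smul_comm, R.chir_sq, neg_mul_neg, Complex.I_mul_I]; simp
  have h4 : R.rho (vec (fun k => w k.castSucc)) * (-Complex.I • R.chir)
      = -((-Complex.I • R.chir) * R.rho (vec (fun k => w k.castSucc))) := by
    rw [mul_smul_comm, smul_mul_assoc, h2, smul_neg]
  rw [negQ_apply, Fin.sum_univ_castSucc, neg_add, map_add, ← h1]
  show (R.rho (vec fun k => w k.castSucc) + w (Fin.last _) • (-Complex.I • R.chir))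
    * (R.rho (vec fun k => w k.castSucc) + w (Fin.last _) • (-Complex.I • R.chir)) = _
  rw [add_mul, mul_add, mul_add, mul_smul_comm, smul_mul_assoc, h4, smul_mul_smul_comm, h3,
    Algebra.algebraMap_eq_smul_one (-(w (Fin.last _) * w (Fin.last _))),
    neg_smul (w (Fin.last _) * w (Fin.last _)), smul_neg, smul_neg]
  abel

/-- The spinor representation of `Cl(2n+1)` on `Σ`, in which `e_{2n+1}` acts as `∓i` on `Σ^±`. -/
def oddRep (R : SpinorModule n Sg) : Cl (2 * n + 1) →ₐ[ℝ] Module.End ℂ Sg :=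
  CliffordAlgebra.lift (negQ (2 * n + 1)) ⟨R.oddVec, R.oddVec_sq⟩

theorem oddRep_clIncl (R : SpinorModule n Sg) (x : Cl (2 * n)) :
    R.oddRep (clIncl (2 * n) x) = R.rho x := by
  have : R.oddRep.comp (clIncl (2 * n)) = R.rho := by
    refine CliffordAlgebra.hom_ext (LinearMap.ext fun w => ?_)
    have h := clIncl_vec w
    simp only [vec] at h
    show R.oddRep (clIncl (2 * n) (CliffordAlgebra.ι _ w)) = R.rho (CliffordAlgebra.ι _ w)
    rw [h, oddRep, CliffordAlgebra.lift_ι_apply]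
    simp [oddVec, vec]
  exact DFunLike.congr_fun this x

end SpinorModule

/-! ### Vector fields, tensors and the Levi-Civita connection -/

section Geometry

variable {m : ℕ} {N : Type u} [TopologicalSpace N] [ChartedSpace (EuclideanSpace ℝ (Fin m)) N]
  [IsManifold (𝓡 m) ∞ N]

/-- (Not necessarily continuous) vector fields on the `m`-dimensional manifold `N`. -/
abbrev VField (m : ℕ) (N : Type u) [TopologicalSpace N]
    [ChartedSpace (EuclideanSpace ℝ (Fin m)) N] : Type u :=
  ∀ x : N, TangentSpace (𝓡 m) x

/-- The vector field `W` is smooth on the set `U`. -/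
def SmoothVFieldOn (W : VField m N) (U : Set N) : Prop :=
  ContMDiffOn (𝓡 m) (𝓡 m).tangent ∞ (fun x => (⟨x, W x⟩ : TangentBundle (𝓡 m) N)) U

/-- Covariant 2-tensors on `N`. -/
abbrev Tensor2 (m : ℕ) (N : Type u) [TopologicalSpace N]
    [ChartedSpace (EuclideanSpace ℝ (Fin m)) N] : Type u :=
  ∀ x : N, TangentSpace (𝓡 m) x → TangentSpace (𝓡 m) x → ℝ

/-- The derivative `W f` of a vector-valued function along a vector field. -/
def dirDeriv {F : Type v} [NormedAddCommGroup F] [NormedSpace ℝ F] (W : VField m N) (f : N → F)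
    (x : N) : F :=
  mfderiv (𝓡 m) 𝓘(ℝ, F) f x (W x)

/-- The Lie bracket of vector fields. -/
abbrev bracket (A B : VField m N) : VField m N := VectorField.mlieBracket (𝓡 m) A B

/-- `lcPair G A B C` is the function `G(∇_A B, C)`, where `∇` is the Levi-Civita connection of the
metric `G`, defined by the Koszul formula. If `G` is only a metric on the tangent bundle of a
foliation and `A, B, C` are tangent to the leaves, every term restricts to the leaves, and this is
`G(∇_A B, C)` for the Levi-Civita connections of the leaves. -/
def lcPair (G : Tensor2 m N) (A B C : VField m N) (x : N) : ℝ :=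
  (1 / 2 : ℝ) *
    (dirDeriv A (fun y => G y (B y) (C y)) x + dirDeriv B (fun y => G y (A y) (C y)) x
      - dirDeriv C (fun y => G y (A y) (B y)) x
      + G x (bracket A B x) (C x) - G x (bracket A C x) (B x) - G x (bracket B C x) (A x))

/-- The Lie derivative `(L_W G)(A, B)` of a 2-tensor. -/
def lieDerivTensor (G : Tensor2 m N) (W A B : VField m N) (x : N) : ℝ :=
  dirDeriv W (fun y => G y (A y) (B y)) x - G x (bracket W A x) (B x) - G x (A x) (bracket W B x)

/-! ### Spin structures, spinor fields, Dirac operators -/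

/-- A spin structure on a rank `d` subbundle `V` of `TN`, with metric `G`: an open cover of `N`,
over each member an orthonormal frame of `V`, and transition functions with values in `Spin(d)`,
satisfying the cocycle condition, which lift the transition functions of the frames. (These are the
frames obtained by projecting local sections of a principal `Spin(d)`-bundle which doubly covers the
bundle of oriented orthonormal frames; in particular they determine the orientation of `V`.) -/
structure SpinStructure (d : ℕ) (V : ∀ x : N, Submodule ℝ (TangentSpace (𝓡 m) x))
    (G : Tensor2 m N) where
  index : Type w
  dom : index → Set N
  frame : index → Fin d → VField m N
  trans : index → index → N → Cl d
  isOpen_dom : ∀ a, IsOpen (dom a)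
  cover : ∀ x, ∃ a, x ∈ dom a
  smooth_frame : ∀ a k, SmoothVFieldOn (frame a k) (dom a)
  span_frame : ∀ a, ∀ x ∈ dom a, Submodule.span ℝ (Set.range fun k => frame a k x) = V x
  orthonormal : ∀ a, ∀ x ∈ dom a, ∀ k l, G x (frame a k x) (frame a l x) = if k = l then 1 else 0
  trans_spin : ∀ a b, ∀ x ∈ dom a ∩ dom b, trans a b x ∈ spinGroup (negQ d)
  -- continuity of the coordinates in the finite-dimensional vector space `Cl d`
  trans_cont : ∀ a b (l : Cl d →ₗ[ℝ] ℝ), ContinuousOn (fun x => l (trans a b x)) (dom a ∩ dom b)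
  trans_cocycle : ∀ a b c, ∀ x ∈ dom a ∩ dom b ∩ dom c,
    trans a b x * trans b c x = trans a c x
  trans_lift : ∀ a b, ∀ x ∈ dom a ∩ dom b, ∀ k,
    trans a b x * gam k * star (trans a b x)
      = ∑ j, G x (frame b k x) (frame a j x) • gam j

namespace SpinStructure

variable {d : ℕ} {V : ∀ x : N, Submodule ℝ (TangentSpace (𝓡 m) x)} {G : Tensor2 m N}
variable {Sg : Type v} [NormedAddCommGroup Sg] [InnerProductSpace ℂ Sg]

/-- Smooth sections of the spinor bundle `P ×_{Spin(d)} Σ`: families of smooth functions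
`σ a : dom a → Σ` which transform by the spin cocycle. (Values outside `dom a` are irrelevant.) -/
structure IsSpinor (P : SpinStructure.{u, w} d V G) (c : Cl d →ₐ[ℝ] Module.End ℂ Sg)
    (φ : P.index → N → Sg) : Prop where
  smooth : ∀ a, ContMDiffOn (𝓡 m) 𝓘(ℝ, Sg) ∞ (φ a) (P.dom a)
  compat : ∀ a b, ∀ x ∈ P.dom a ∩ P.dom b, φ a x = c (P.trans a b x) (φ b x)

/-- The covariant derivative `∇_A φ` of a spinor field, in the spin frame `a`:
`A(σ) + ½ ∑_{i<j} G'(∇_A e_i, e_j) c(e_i) c(e_j) σ`, where `∇` is the orthogonal projection to `V`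
of the Levi-Civita connection of `G'`, a metric extending that of `V`. -/
def spinCov (P : SpinStructure.{u, w} d V G) (G' : Tensor2 m N) (c : Cl d →ₐ[ℝ] Module.End ℂ Sg)
    (A : VField m N) (φ : P.index → N → Sg) (a : P.index) (x : N) : Sg :=
  dirDeriv A (φ a) x
    + (1 / 2 : ℝ) • ∑ i : Fin d, ∑ j ∈ Finset.Ioi i,
        lcPair G' A (P.frame a i) (P.frame a j) x • c (gam i * gam j) (φ a x)

/-- The Dirac operator `∑_k c(e_k) ∇_{e_k}` of a spin structure, for the Levi-Civita connection of
`G`. For `V = TN` this is the Dirac operator of the spin manifold `(N, G)`; for `V` the tangent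
bundle of a foliation it is the family of Dirac operators of the leaves. -/
def dirac (P : SpinStructure.{u, w} d V G) (c : Cl d →ₐ[ℝ] Module.End ℂ Sg)
    (φ : P.index → N → Sg) (a : P.index) (x : N) : Sg :=
  ∑ k : Fin d, c (gam k) (P.spinCov G c (P.frame a k) φ a x)

end SpinStructure

/-- The Riemannian volume density `√det(G(∂_i, ∂_j))` of the metric `G` in the chart at `x₀`, at
the point of the chart's image with coordinates `z`. -/
def volDensity (G : Tensor2 m N) (x₀ : N) (z : EuclideanSpace ℝ (Fin m)) : ℝ :=
  let e := extChartAt (𝓡 m) x₀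
  let del : Fin m → TangentSpace (𝓡 m) (e.symm z) := fun i =>
    mfderiv 𝓘(ℝ, EuclideanSpace ℝ (Fin m)) (𝓡 m) e.symm z (EuclideanSpace.single i (1 : ℝ))
  √(Matrix.of fun i j => G (e.symm z) (del i) (del j)).det

end Geometry

/-! ### Fibrations over the circle with spin fibers -/

/-- A fibration `p : N → S¹` with `2n`-dimensional Riemannian fibers, with a connection (given by
its horizontal lift, the horizontal distribution being the range of `lift`) and a Riemannian
metric on the base. The metrics of the fibers are extended by zero on horizontal vectors to a
2-tensor `g` on `N`. -/
structure Fibration (n : ℕ) (N : Type u) [TopologicalSpace N]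
    [ChartedSpace (EuclideanSpace ℝ (Fin (2 * n + 1))) N]
    [IsManifold (𝓡 (2 * n + 1)) ∞ N] where
  p : N → Circle
  p_smooth : ContMDiff (𝓡 (2 * n + 1)) (𝓡 1) ∞ p
  p_surj : Function.Surjective p
  p_subm : ∀ x, Function.Surjective (mfderiv (𝓡 (2 * n + 1)) (𝓡 1) p x)
  lift : ∀ x : N, TangentSpace (𝓡 1) (p x) →ₗ[ℝ] TangentSpace (𝓡 (2 * n + 1)) x
  lift_section : ∀ x v, mfderiv (𝓡 (2 * n + 1)) (𝓡 1) p x (lift x v) = v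
  lift_smooth : ∀ Y : VField 1 Circle, SmoothVFieldOn Y Set.univ →
    SmoothVFieldOn (m := 2 * n + 1) (fun x => lift x (Y (p x))) Set.univ
  g : ∀ x : N, TangentSpace (𝓡 (2 * n + 1)) x →L[ℝ] TangentSpace (𝓡 (2 * n + 1)) x →L[ℝ] ℝ
  g_smooth : ContMDiff (𝓡 (2 * n + 1)) ((𝓡 (2 * n + 1)).prod
      𝓘(ℝ, EuclideanSpace ℝ (Fin (2 * n + 1)) →L[ℝ] EuclideanSpace ℝ (Fin (2 * n + 1)) →L[ℝ] ℝ)) ∞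
    (fun x => Bundle.TotalSpace.mk'
      (EuclideanSpace ℝ (Fin (2 * n + 1)) →L[ℝ] EuclideanSpace ℝ (Fin (2 * n + 1)) →L[ℝ] ℝ) x (g x))
  g_symm : ∀ x u w, g x u w = g x w u
  g_pos : ∀ x u, mfderiv (𝓡 (2 * n + 1)) (𝓡 1) p x u = 0 → u ≠ 0 → 0 < g x u u
  g_hor : ∀ x v w, g x (lift x v) w = 0
  gM : Bundle.ContMDiffRiemannianMetric (𝓡 1) ∞ (EuclideanSpace ℝ (Fin 1))
    (fun z : Circle => TangentSpace (𝓡 1) z)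

namespace Fibration

variable {n : ℕ} {N : Type u} [TopologicalSpace N]
  [ChartedSpace (EuclideanSpace ℝ (Fin (2 * n + 1))) N] [IsManifold (𝓡 (2 * n + 1)) ∞ N]
variable {Sg : Type v} [NormedAddCommGroup Sg] [InnerProductSpace ℂ Sg]

/-- The differential of the projection. -/
def dp (X : Fibration n N) (x : N) : TangentSpace (𝓡 (2 * n + 1)) x →ₗ[ℝ] TangentSpace (𝓡 1) (X.p x) :=
  (mfderiv (𝓡 (2 * n + 1)) (𝓡 1) X.p x).toLinearMap

/-- The vertical tangent space `ker dp`. -/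
def vert (X : Fibration n N) (x : N) : Submodule ℝ (TangentSpace (𝓡 (2 * n + 1)) x) :=
  LinearMap.ker (X.dp x)

/-- The fiberwise metric, extended by zero, as a 2-tensor. -/
def gTensor (X : Fibration n N) : Tensor2 (2 * n + 1) N := fun x u w => X.g x u w

/-- The metric `g + t⁻² p^* g^M` on `N`. -/
def metric (X : Fibration n N) (t : ℝ) : Tensor2 (2 * n + 1) N :=
  fun x u w => X.g x u w + (t ^ 2)⁻¹ * X.gM.inner (X.p x) (X.dp x u) (X.dp x w)

/-- The horizontal lift `Ỹ` of a vector field `Y` on the base. -/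
def horLift (X : Fibration n N) (Y : VField 1 Circle) : VField (2 * n + 1) N :=
  fun x => X.lift x (Y (X.p x))

/-- A spin structure on the fibers, depending continuously on the fiber: a spin structure on the
vertical tangent bundle. -/
abbrev FiberSpin (X : Fibration n N) : Type _ := SpinStructure.{u, w} (2 * n) X.vert X.gTensor

/-- A smooth vector field on the base which has unit length for the metric `g^M`. -/
structure UnitField (X : Fibration n N) where
  field : VField 1 Circle
  smooth : SmoothVFieldOn field Set.univ
  unit : ∀ z, X.gM.inner z (field z) (field z) = 1

variable (X : Fibration n N) (P : FiberSpin.{u, w} X)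

/-- The frame `(e₁, …, e_{2n}, t ∂̃_θ)` of `TN`. -/
def totalFrame (dth : X.UnitField) (t : ℝ) (a : P.index) : Fin (2 * n + 1) → VField (2 * n + 1) N :=
  Fin.snoc (α := fun _ => VField (2 * n + 1) N) (P.frame a) (fun x => t • X.horLift dth.field x)

theorem dp_frame (a : P.index) {x : N} (hx : x ∈ P.dom a) (k : Fin (2 * n)) :
    X.dp x (P.frame a k x) = 0 := by
  have : P.frame a k x ∈ X.vert x := by
    rw [← P.span_frame a x hx]; exact Submodule.subset_span ⟨k, rfl⟩
  exact this

theorem dp_horLift (Y : VField 1 Circle) (x : N) : X.dp x (X.horLift Y x) = Y (X.p x) :=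
  X.lift_section x _

theorem metric_frame (t : ℝ) (a : P.index) {x : N} (hx : x ∈ P.dom a) (k : Fin (2 * n))
    (w : TangentSpace (𝓡 (2 * n + 1)) x) :
    X.metric t x (P.frame a k x) w = X.g x (P.frame a k x) w := by
  rw [metric, X.dp_frame P a hx k]; simp

theorem metric_frame_last (dth : X.UnitField) (t : ℝ) (a : P.index) {x : N} (hx : x ∈ P.dom a)
    (k : Fin (2 * n)) : X.metric t x (P.frame a k x) (t • X.horLift dth.field x) = 0 := by
  rw [X.metric_frame P t a hx, X.g_symm, map_smul]
  show (t • X.g x (X.lift x (dth.field (X.p x)))) _ = 0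
  show t • (X.g x (X.lift x (dth.field (X.p x))) _) = 0
  rw [X.g_hor, smul_zero]

theorem metric_last_frame (dth : X.UnitField) (t : ℝ) (a : P.index) {x : N} (hx : x ∈ P.dom a)
    (k : Fin (2 * n)) : X.metric t x (t • X.horLift dth.field x) (P.frame a k x) = 0 := by
  rw [metric, X.dp_frame P a hx k, map_zero, mul_zero, add_zero, map_smul]
  show t • (X.g x (X.lift x (dth.field (X.p x))) _) = 0
  rw [X.g_hor, smul_zero]

theorem metric_last (dth : X.UnitField) {t : ℝ} (ht : 0 < t) (x : N) :
    X.metric t x (t • X.horLift dth.field x) (t • X.horLift dth.field x) = 1 := by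
  have h1 : X.g x (t • X.horLift dth.field x) (t • X.horLift dth.field x) = 0 := by
    rw [show t • X.horLift dth.field x = X.lift x (t • dth.field (X.p x)) from
      (map_smul (X.lift x) t _).symm, X.g_hor]
  rw [metric, h1, map_smul, X.dp_horLift, zero_add, map_smul, map_smul]
  show (t ^ 2)⁻¹ * (t • (t • X.gM.inner (X.p x) (dth.field (X.p x)) (dth.field (X.p x)))) = 1
  rw [dth.unit]
  simp only [smul_eq_mul, mul_one]
  field_simp

theorem base_span (dth : X.UnitField) (z : Circle) (v : TangentSpace (𝓡 1) z) :
    ∃ c : ℝ, v = c • dth.field z := by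
  have h0 : dth.field z ≠ 0 := by
    intro h
    have := dth.unit z
    rw [h] at this
    simp at this
  have h1 : Module.finrank ℝ (TangentSpace (𝓡 1) z) = 1 := by
    show Module.finrank ℝ (EuclideanSpace ℝ (Fin 1)) = 1
    simp
  obtain ⟨c, hc⟩ := (finrank_eq_one_iff_of_nonzero' _ h0).1 h1 v
  exact ⟨c, hc.symm⟩

/-- The spin structure on `(N, g + t⁻² p^* g^M)` induced by the spin structure on the fibers and
the trivial one on the circle: the spin frames over `(e₁, …, e_{2n}, t ∂̃_θ)`, with the transition
functions of the fibers included in `Spin(2n+1)`. -/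
def totalSpin (dth : X.UnitField) (t : ℝ) (ht : 0 < t) :
    SpinStructure.{u, w} (m := 2 * n + 1) (N := N) (2 * n + 1) (fun _ => ⊤) (X.metric t) where
  index := P.index
  dom := P.dom
  frame := X.totalFrame P dth t
  trans a b x := clIncl (2 * n) (P.trans a b x)
  isOpen_dom := P.isOpen_dom
  cover := P.cover
  smooth_frame a k := by
    refine Fin.lastCases ?_ (fun j => ?_) k
    · simp only [totalFrame, Fin.snoc_last]
      have h := X.lift_smooth dth.field dth.smooth
      exact (h.mono (Set.subset_univ _)).const_smul_section (a := t)
    · simp only [totalFrame, Fin.snoc_castSucc]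
      exact P.smooth_frame a j
  span_frame a x hx := by
    refine eq_top_iff.2 fun w _ => ?_
    obtain ⟨c, hc⟩ := X.base_span dth _ (X.dp x w)
    have hw : w = (w - c • X.horLift dth.field x) + c • X.horLift dth.field x := by abel
    rw [hw]
    refine add_mem ?_ ?_
    · have hv : w - c • X.horLift dth.field x ∈ X.vert x := by
        show X.dp x _ = 0
        rw [map_sub, map_smul, X.dp_horLift, hc, sub_self]
      rw [← P.span_frame a x hx] at hv
      refine Submodule.span_mono ?_ hv
      rintro _ ⟨k, rfl⟩
      exact ⟨k.castSucc, by simp [totalFrame]⟩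
    · have : c • X.horLift dth.field x = (c * t⁻¹) • (t • X.horLift dth.field x) := by
        rw [smul_smul, mul_assoc, inv_mul_cancel₀ ht.ne', mul_one]
      rw [this]
      refine Submodule.smul_mem _ _ (Submodule.subset_span ⟨Fin.last _, ?_⟩)
      simp [totalFrame]
  orthonormal a x hx k l := by
    refine Fin.lastCases ?_ (fun i => ?_) k
    · refine Fin.lastCases ?_ (fun j => ?_) l
      · simp only [totalFrame, Fin.snoc_last, if_true]
        exact X.metric_last dth ht x
      · have hne : Fin.last (2 * n) ≠ j.castSucc := (Fin.castSucc_lt_last j).ne'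
        simp only [totalFrame, Fin.snoc_last, Fin.snoc_castSucc, if_neg hne]
        exact X.metric_last_frame P dth t a hx j
    · refine Fin.lastCases ?_ (fun j => ?_) l
      · have hne : i.castSucc ≠ Fin.last (2 * n) := (Fin.castSucc_lt_last i).ne
        simp only [totalFrame, Fin.snoc_last, Fin.snoc_castSucc, if_neg hne]
        exact X.metric_frame_last P dth t a hx i
      · simp only [totalFrame, Fin.snoc_castSucc, Fin.castSucc_inj]
        rw [X.metric_frame P t a hx]
        exact P.orthonormal a x hx i j
  trans_spin a b x hx := clIncl_spin (P.trans_spin a b x hx)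
  trans_cont a b l := P.trans_cont a b (l ∘ₗ (clIncl (2 * n)).toLinearMap)
  trans_cocycle a b c x hx := by
    rw [← map_mul, P.trans_cocycle a b c x hx]
  trans_lift a b x hx k := by
    rw [Fin.sum_univ_castSucc]
    refine Fin.lastCases ?_ (fun i => ?_) k
    · simp only [totalFrame, Fin.snoc_last, Fin.snoc_castSucc]
      rw [X.metric_last dth ht x, one_smul, Finset.sum_eq_zero, zero_add,
        clIncl_conj_last (P.trans_spin a b x hx)]
      intro j _
      rw [X.metric_last_frame P dth t a hx.1 j, zero_smul]
    · simp only [totalFrame, Fin.snoc_last, Fin.snoc_castSucc]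
      rw [X.metric_frame_last P dth t b hx.2 i, zero_smul, add_zero, ← clIncl_star, ← clIncl_gam,
        ← map_mul, ← map_mul, P.trans_lift a b x hx i, map_sum]
      refine Finset.sum_congr rfl fun j _ => ?_
      rw [X.metric_frame P t b hx.2, map_smul, clIncl_gam]
      rfl

/-- The Dirac operator `δ_t` of the spin manifold `(N, g + t⁻² p^* g^M)`. -/
def delta (R : SpinorModule n Sg) (dth : X.UnitField) (t : ℝ) (ht : 0 < t)
    (φ : P.index → N → Sg) : P.index → N → Sg :=
  (X.totalSpin P dth t ht).dirac R.oddRep φ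

/-- The spinor fields of `N` are the sections of the spinor bundle of the fibers. -/
theorem totalSpin_isSpinor_iff (R : SpinorModule n Sg) (dth : X.UnitField) (t : ℝ) (ht : 0 < t)
    (φ : P.index → N → Sg) :
    (X.totalSpin P dth t ht).IsSpinor R.oddRep φ ↔ P.IsSpinor R.rho φ := by
  refine ⟨fun h => ⟨h.smooth, fun a b x hx => ?_⟩, fun h => ⟨h.smooth, fun a b x hx => ?_⟩⟩
  · rw [← R.oddRep_clIncl]; exact h.compat a b x hx
  · exact (h.compat a b x hx).trans
      (by rw [← R.oddRep_clIncl]; rfl)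

/-- Smooth sections of the half-spinor bundle `S^+`. -/
def IsPosSpinor (R : SpinorModule n Sg) (φ : P.index → N → Sg) : Prop :=
  P.IsSpinor R.rho φ ∧ ∀ a, ∀ x ∈ P.dom a, R.chir (φ a x) = φ a x

/-- Smooth sections of the half-spinor bundle `S^-`. -/
def IsNegSpinor (R : SpinorModule n Sg) (φ : P.index → N → Sg) : Prop :=
  P.IsSpinor R.rho φ ∧ ∀ a, ∀ x ∈ P.dom a, R.chir (φ a x) = -φ a x

/-- `D'` is the formal adjoint of `D`, as operators `C^∞(N, S^+) → C^∞(N, S^-)` and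
`C^∞(N, S^-) → C^∞(N, S^+)`, for the pointwise Hermitian product of spinors and the Riemannian
volume of `(N, G)`: `∫ ⟨D φ, ψ⟩ = ∫ ⟨φ, D' ψ⟩` for all sections `ψ` of `S^-` and all sections `φ`
of `S^+` which are compactly supported in a set over which both a coordinate chart and a spin frame
are given (the chart at `x₀` and the spin frame `a`, in which the integral is written). -/
def IsFormalAdjoint (R : SpinorModule n Sg) (G : Tensor2 (2 * n + 1) N)
    (D D' : (P.index → N → Sg) → P.index → N → Sg) : Prop :=
  ∀ φ ψ, IsPosSpinor X P R φ → IsNegSpinor X P R ψ →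
    ∀ (a : P.index) (x₀ : N) (K : Set N), IsCompact K →
      K ⊆ P.dom a ∩ (extChartAt (𝓡 (2 * n + 1)) x₀).source →
      (∀ b, ∀ x ∈ P.dom b, x ∉ K → φ b x = 0) →
      let e := extChartAt (𝓡 (2 * n + 1)) x₀
      ∫ z in e.target ∩ e.symm ⁻¹' P.dom a,
          (volDensity G x₀ z : ℂ) * inner ℂ (D φ a (e.symm z)) (ψ a (e.symm z))
        = ∫ z in e.target ∩ e.symm ⁻¹' P.dom a,
          (volDensity G x₀ z : ℂ) * inner ℂ (φ a (e.symm z)) (D' ψ a (e.symm z))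

/-- The family `D` of Dirac operators of the fibers. -/
def fiberDirac (R : SpinorModule n Sg) (φ : P.index → N → Sg) : P.index → N → Sg :=
  P.dirac R.rho φ

/-- The trace `tr(L_Ỹ g)`, the contraction by `g` of the Lie derivative of `g` along the
horizontal lift of `Y`, computed in the vertical orthonormal frame `a`. -/
def traceLie (Y : VField 1 Circle) (a : P.index) (x : N) : ℝ :=
  ∑ k, lieDerivTensor X.gTensor (X.horLift Y) (P.frame a k) (P.frame a k) x

/-- The operator `∇̃_Y = ∇_Ỹ + ¼ tr(L_Ỹ g)`, with `∇` the vertical projection of the Levi-Civita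
connection of `g + p^* g^M`. -/
def nablaTilde (R : SpinorModule n Sg) (Y : VField 1 Circle) (φ : P.index → N → Sg)
    (a : P.index) (x : N) : Sg :=
  P.spinCov (X.metric 1) R.rho (X.horLift Y) φ a x
    + (1 / 4 * X.traceLie P Y a x) • φ a x

end Fibration

end AdiabaticDirac

end

/-! Work in a local orthonormal frame (e_1, …, e_{2n}, T) of the total space, with e_k vertical and
T = t ∂̃_θ. Inner products in such a frame are constant, so the Koszul formula involves only
brackets. Both [e_k, e_l] and [T, e_k] are vertical, because vertical fields project to zero and T
projects to a field on the circle (`mfderiv_bracket_eq_zero`). All connection coefficients follow: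
the purely vertical ones are those of the fibers; G(∇_{e_i} e_j, T) is symmetric in i, j (the second
fundamental form of the fibers); G(∇_T e_i, e_j) is linear in t; and G(∇_T e_i, T) = 0.

In δ_t = ∑ c(e_k) ∇_{e_k} + c(T) ∇_T the fiber coefficients therefore give the fiber Dirac operator,
and the last summand gives c(T) times t ∇_{∂̃_θ}. What remains is the Clifford contraction of the
second fundamental form. Being symmetric, it collapses to minus its trace (`sum_symm_smul_mul`), and
by `traceLie_eq` this is exactly the correction ¼ tr(L g) in ∇̃. The outcome is δ_t = D + t c(T₁) ∇̃
with T₁ = ∂̃_θ and c(T₁) equal to -i times chirality (`delta_eq`). Since ∇̃ preserves chirality and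
the fiber Dirac operator reverses it (`chir_nablaTilde`, `chir_fiberDirac`), the matrix form is read
off by projecting to S^±.

The formal adjoint is the fiber Dirac operator restricted to S^-. Pointwise, ⟨Dφ, ψ⟩ - ⟨φ, Dψ⟩ is
minus a fiberwise divergence, that of ∑ ⟨φ, c(e_j)ψ⟩ e_j (`inner_dirac_sub`). For the volume of the
total space one needs the divergence in N. The two agree since [T, e_j] has no T-component
(`sum_coordMetric_lieBracket`), and the divergence theorem in a chart finishes
(`integral_frame_div_eq_zero`, `isFormalAdjoint_fiberDirac`). -/

noncomputable section

namespace AdiabaticDirac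

/-! ### Vector fields, derivatives and brackets in charts; brackets of projectable fields -/

section Coordinates

theorem mlieBracket_eq_lieBracket {E : Type*} [NormedAddCommGroup E] [NormedSpace ℝ E]
    (V W : ∀ x : E, TangentSpace 𝓘(ℝ, E) x) :
    VectorField.mlieBracket 𝓘(ℝ, E) V W = VectorField.lieBracket ℝ V W := by
  rw [← VectorField.mlieBracketWithin_univ, VectorField.mlieBracketWithin_eq_lieBracketWithin]
  exact VectorField.lieBracketWithin_univ

theorem minSmoothness_two_le : minSmoothness ℝ 2 ≤ (∞ : WithTop ℕ∞) := by
  rw [minSmoothness_of_isRCLikeNormedField]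
  exact WithTop.coe_le_coe.2 (le_top : (2 : ℕ∞) ≤ ⊤)

variable {m : ℕ} {N : Type u} [TopologicalSpace N] [ChartedSpace (EuclideanSpace ℝ (Fin m)) N]
  [IsManifold (𝓡 m) ∞ N]

/-- The coordinate expression of a vector field in the chart at `x₀`. -/
def coordField (x₀ : N) (W : VField m N) (z : EuclideanSpace ℝ (Fin m)) :
    EuclideanSpace ℝ (Fin m) :=
  VectorField.mpullback 𝓘(ℝ, EuclideanSpace ℝ (Fin m)) (𝓡 m) (extChartAt (𝓡 m) x₀).symm W z

theorem contMDiffAt_chart_symm {x₀ : N} {z : EuclideanSpace ℝ (Fin m)}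
    (hz : z ∈ (extChartAt (𝓡 m) x₀).target) :
    ContMDiffAt 𝓘(ℝ, EuclideanSpace ℝ (Fin m)) (𝓡 m) ∞ (extChartAt (𝓡 m) x₀).symm z :=
  (contMDiffOn_extChartAt_symm x₀).contMDiffAt ((isOpen_extChartAt_target x₀).mem_nhds hz)

theorem isInvertible_mfderiv_chart_symm {x₀ : N} {z : EuclideanSpace ℝ (Fin m)}
    (hz : z ∈ (extChartAt (𝓡 m) x₀).target) :
    (mfderiv 𝓘(ℝ, EuclideanSpace ℝ (Fin m)) (𝓡 m) (extChartAt (𝓡 m) x₀).symm z).IsInvertible := by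
  have : IsManifold (𝓡 m) 1 N := IsManifold.of_le (n := ∞) (by simp)
  have h := isInvertible_mfderivWithin_extChartAt_symm (I := 𝓡 m) hz
  rwa [ModelWithCorners.range_eq_univ, mfderivWithin_univ] at h

theorem mfderiv_chart_symm_coordField {x₀ : N} {z : EuclideanSpace ℝ (Fin m)}
    (hz : z ∈ (extChartAt (𝓡 m) x₀).target) (W : VField m N) :
    mfderiv 𝓘(ℝ, EuclideanSpace ℝ (Fin m)) (𝓡 m) (extChartAt (𝓡 m) x₀).symm z (coordField x₀ W z)
      = W ((extChartAt (𝓡 m) x₀).symm z) :=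
  (isInvertible_mfderiv_chart_symm hz).self_apply_inverse _

theorem contDiffAt_coordField {x₀ : N} {W : VField m N} {U : Set N} (hU : IsOpen U)
    (hW : SmoothVFieldOn W U) {z : EuclideanSpace ℝ (Fin m)}
    (hz : z ∈ (extChartAt (𝓡 m) x₀).target) (hzU : (extChartAt (𝓡 m) x₀).symm z ∈ U) :
    ContDiffAt ℝ ∞ (coordField x₀ W) z := by
  have h1 := (hW.contMDiffAt (hU.mem_nhds hzU))
  have h2 := h1.mpullback_vectorField_preimage (contMDiffAt_chart_symm hz)
    (isInvertible_mfderiv_chart_symm hz) (by simp)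
  exact contMDiffAt_vectorSpace_iff_contDiffAt.1 h2

theorem dirDeriv_coord {F : Type v} [NormedAddCommGroup F] [NormedSpace ℝ F] {f : N → F}
    {x₀ : N} {z : EuclideanSpace ℝ (Fin m)} (hz : z ∈ (extChartAt (𝓡 m) x₀).target)
    (W : VField m N) (hf : MDifferentiableAt (𝓡 m) 𝓘(ℝ, F) f ((extChartAt (𝓡 m) x₀).symm z)) :
    dirDeriv W f ((extChartAt (𝓡 m) x₀).symm z)
      = fderiv ℝ (f ∘ (extChartAt (𝓡 m) x₀).symm) z (coordField x₀ W z) := by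
  rw [← mfderiv_eq_fderiv, mfderiv_comp z hf
    ((contMDiffAt_chart_symm hz).mdifferentiableAt (by simp)), dirDeriv]
  exact congrArg _ (mfderiv_chart_symm_coordField hz W).symm

/-- Naturality of the bracket under pullback by the inverse chart. It reduces facts about manifold
brackets to the bracket of Euclidean vector fields. -/
theorem mfderiv_chart_symm_lieBracket {A B : VField m N} {U : Set N} (hU : IsOpen U)
    (hA : SmoothVFieldOn A U) (hB : SmoothVFieldOn B U) {x₀ : N} {z : EuclideanSpace ℝ (Fin m)}
    (hz : z ∈ (extChartAt (𝓡 m) x₀).target) (hzU : (extChartAt (𝓡 m) x₀).symm z ∈ U) :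
    mfderiv 𝓘(ℝ, EuclideanSpace ℝ (Fin m)) (𝓡 m) (extChartAt (𝓡 m) x₀).symm z
      (VectorField.lieBracket ℝ (coordField x₀ A) (coordField x₀ B) z : EuclideanSpace ℝ (Fin m))
      = bracket A B ((extChartAt (𝓡 m) x₀).symm z) := by
  have : IsManifold (𝓡 m) (minSmoothness ℝ 3) N := IsManifold.of_le (n := ∞) (by
    rw [minSmoothness_of_isRCLikeNormedField]; exact WithTop.coe_le_coe.2 (le_top : (3 : ℕ∞) ≤ ⊤))
  have h1 := (hA.contMDiffAt (hU.mem_nhds hzU)).mdifferentiableAt (by simp)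
  have h2 := (hB.contMDiffAt (hU.mem_nhds hzU)).mdifferentiableAt (by simp)
  have h3 := VectorField.mpullback_mlieBracket (n := ∞) h1 h2 (contMDiffAt_chart_symm hz)
    minSmoothness_two_le
  have h4 := congrArg (mfderiv 𝓘(ℝ, EuclideanSpace ℝ (Fin m)) (𝓡 m)
    (extChartAt (𝓡 m) x₀).symm z) h3
  have h5 : VectorField.mlieBracket 𝓘(ℝ, EuclideanSpace ℝ (Fin m)) (coordField x₀ A)
      (coordField x₀ B) z = VectorField.lieBracket ℝ (coordField x₀ A) (coordField x₀ B) z :=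
    congrFun (mlieBracket_eq_lieBracket _ _) z
  exact (congrArg _ h5.symm).trans <| h4.symm.trans (mfderiv_chart_symm_coordField hz _)

theorem chart_symm_mem_nhds {x₀ : N} {z : EuclideanSpace ℝ (Fin m)}
    (hz : z ∈ (extChartAt (𝓡 m) x₀).target) {U : Set N} (hU : IsOpen U)
    (hzU : (extChartAt (𝓡 m) x₀).symm z ∈ U) :
    ∀ᶠ y in nhds z, y ∈ (extChartAt (𝓡 m) x₀).target ∧ (extChartAt (𝓡 m) x₀).symm y ∈ U :=
  Filter.inter_mem ((isOpen_extChartAt_target x₀).mem_nhds hz)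
    ((contMDiffAt_chart_symm hz).continuousAt.preimage_mem_nhds (hU.mem_nhds hzU))

theorem contDiffAt_comp_chart_symm {F : Type v} [NormedAddCommGroup F] [NormedSpace ℝ F]
    {f : N → F} {U : Set N} (hU : IsOpen U) (hf : ContMDiffOn (𝓡 m) 𝓘(ℝ, F) ∞ f U) {x₀ : N}
    {z : EuclideanSpace ℝ (Fin m)} (hz : z ∈ (extChartAt (𝓡 m) x₀).target)
    (hzU : (extChartAt (𝓡 m) x₀).symm z ∈ U) :
    ContDiffAt ℝ ∞ (f ∘ (extChartAt (𝓡 m) x₀).symm) z :=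
  ((hf.contMDiffAt (hU.mem_nhds hzU)).comp z (contMDiffAt_chart_symm hz)).contDiffAt

/-- In a chart the derivative is the differential applied to a smooth field. This is needed so that
iterated derivatives A(B h) can themselves be computed in charts. -/
theorem contMDiffOn_dirDeriv {F : Type v} [NormedAddCommGroup F] [NormedSpace ℝ F] {W : VField m N}
    {U : Set N} (hU : IsOpen U) (hW : SmoothVFieldOn W U) {f : N → F}
    (hf : ContMDiffOn (𝓡 m) 𝓘(ℝ, F) ∞ f U) : ContMDiffOn (𝓡 m) 𝓘(ℝ, F) ∞ (dirDeriv W f) U := by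
  intro x hx
  refine ContMDiffAt.contMDiffWithinAt ?_
  set e := extChartAt (𝓡 m) x with he
  have hz : e x ∈ e.target := mem_extChartAt_target x
  have hzU : e.symm (e x) ∈ U := by rwa [he, extChartAt_to_inv]
  have h1 : ContDiffAt ℝ ∞ (fun z => fderiv ℝ (f ∘ e.symm) z (coordField x W z)) (e x) :=
    ((contDiffAt_comp_chart_symm hU hf hz hzU).fderiv_right (by simp)).clm_apply
      (contDiffAt_coordField hU hW hz hzU)
  have h2 := h1.contMDiffAt.comp x (contMDiffAt_extChartAt (I := 𝓡 m) (n := ∞) (x := x))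
  refine h2.congr_of_eventuallyEq ?_
  filter_upwards [hU.mem_nhds hx, extChartAt_source_mem_nhds (I := 𝓡 m) x] with y hy hys
  have h3 : e.symm (e y) = y := e.left_inv hys
  have h4 := dirDeriv_coord (e.map_source hys) W (f := f) (by
    rw [h3]; exact (hf.contMDiffAt (hU.mem_nhds hy)).mdifferentiableAt (by simp))
  rw [h3] at h4
  exact h4

/-- A smooth function satisfies `[A, B] h = A (B h) - B (A h)`. -/
theorem dirDeriv_bracket {F : Type v} [NormedAddCommGroup F] [NormedSpace ℝ F] {A B : VField m N}
    {U : Set N} (hU : IsOpen U) (hA : SmoothVFieldOn A U) (hB : SmoothVFieldOn B U) {h : N → F}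
    (hh : ContMDiffOn (𝓡 m) 𝓘(ℝ, F) ∞ h U) {x : N} (hx : x ∈ U) :
    dirDeriv (bracket A B) h x
      = dirDeriv A (dirDeriv B h) x - dirDeriv B (dirDeriv A h) x := by
  set e := extChartAt (𝓡 m) x with he
  have hz : e x ∈ e.target := mem_extChartAt_target x
  have hxx : e.symm (e x) = x := by rw [he, extChartAt_to_inv]
  have hzU : e.symm (e x) ∈ U := by rwa [hxx]
  have hm : ∀ {f : N → F}, ContMDiffOn (𝓡 m) 𝓘(ℝ, F) ∞ f U → ∀ {y}, y ∈ U →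
      MDifferentiableAt (𝓡 m) 𝓘(ℝ, F) f y := fun hf y hy =>
    (hf.contMDiffAt (hU.mem_nhds hy)).mdifferentiableAt (by simp)
  have key : ∀ W : VField m N, dirDeriv W h ∘ e.symm
      =ᶠ[nhds (e x)] fun z => fderiv ℝ (h ∘ e.symm) z (coordField x W z) := fun W => by
    filter_upwards [chart_symm_mem_nhds hz hU hzU] with y hy
    exact dirDeriv_coord hy.1 W (hm hh hy.2)
  have h1 := dirDeriv_coord hz A (hm (contMDiffOn_dirDeriv hU hB hh) hzU)
  have h2 := dirDeriv_coord hz B (hm (contMDiffOn_dirDeriv hU hA hh) hzU)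
  have h3 := dirDeriv_coord hz (bracket A B) (hm hh hzU)
  have h4 : coordField x (bracket A B) (e x)
      = VectorField.lieBracket ℝ (coordField x A) (coordField x B) (e x) := by
    refine (isInvertible_mfderiv_chart_symm hz).injective ?_
    rw [mfderiv_chart_symm_coordField hz]
    exact (mfderiv_chart_symm_lieBracket hU hA hB hz hzU).symm
  -- In coordinates the identity is the symmetry of the second derivative.
  rw [h4, VectorField.fderiv_apply_lieBracket (contDiffAt_comp_chart_symm hU hh hz hzU)
    minSmoothness_two_le
    ((contDiffAt_coordField hU hB hz hzU).differentiableAt (by simp))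
    ((contDiffAt_coordField hU hA hz hzU).differentiableAt (by simp))] at h3
  rw [(key B).fderiv_eq] at h1
  rw [(key A).fderiv_eq] at h2
  rw [hxx] at h1 h2 h3
  rw [h1, h2, h3]

omit [IsManifold (𝓡 m) ∞ N] in
theorem dirDeriv_congr {F : Type v} [NormedAddCommGroup F] [NormedSpace ℝ F] {f g : N → F} {x : N}
    (h : f =ᶠ[nhds x] g) (W : VField m N) : dirDeriv W f x = dirDeriv W g x := by
  rw [dirDeriv, dirDeriv, h.mfderiv_eq]
  rfl

omit [IsManifold (𝓡 m) ∞ N] in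
theorem dirDeriv_const {F : Type v} [NormedAddCommGroup F] [NormedSpace ℝ F] {f : N → F} {x : N}
    {c : F} (h : ∀ᶠ y in nhds x, f y = c) (W : VField m N) : dirDeriv W f x = 0 := by
  rw [dirDeriv_congr (g := fun _ => c) h, dirDeriv, mfderiv_const]
  rfl

/-- The bracket of a projectable vector field and a vertical one is vertical. -/
theorem mfderiv_bracket_eq_zero {k : ℕ} {M : Type w} [TopologicalSpace M]
    [ChartedSpace (EuclideanSpace ℝ (Fin k)) M] [IsManifold (𝓡 k) ∞ M] {p : N → M}
    (hp : ContMDiff (𝓡 m) (𝓡 k) ∞ p) {U : Set N} (hU : IsOpen U) {A B : VField m N}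
    (hA : SmoothVFieldOn A U) (hB : SmoothVFieldOn B U) {Y : VField k M}
    (hY : SmoothVFieldOn Y Set.univ) (hAY : ∀ y ∈ U, mfderiv (𝓡 m) (𝓡 k) p y (A y) = Y (p y))
    (hB0 : ∀ y ∈ U, mfderiv (𝓡 m) (𝓡 k) p y (B y) = 0) {x : N} (hx : x ∈ U) :
    mfderiv (𝓡 m) (𝓡 k) p x (bracket A B x) = 0 := by
  have : IsManifold (𝓡 k) 1 M := IsManifold.of_le (n := ∞) (by simp)
  set e := extChartAt (𝓡 k) (p x) with he
  set O : Set N := U ∩ p ⁻¹' e.source with hO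
  have hOo : IsOpen O := hU.inter ((isOpen_extChartAt_source (p x)).preimage hp.continuous)
  have hxO : x ∈ O := ⟨hx, mem_extChartAt_source (p x)⟩
  have hes : ∀ y ∈ e.source, ContMDiffAt (𝓡 k) 𝓘(ℝ, EuclideanSpace ℝ (Fin k)) ∞ e y :=
    fun y hy => contMDiffAt_extChartAt' (by simpa [he] using hy)
  -- Brackets are tested on the vector-valued function e ∘ p, with e a chart of the base: its
  -- differential along W vanishes exactly when dp(W) does.
  have hh : ContMDiffOn (𝓡 m) 𝓘(ℝ, EuclideanSpace ℝ (Fin k)) ∞ (e ∘ p) O := fun y hy =>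
    ((hes _ hy.2).comp y (hp y)).contMDiffWithinAt
  have hch : ∀ y ∈ O, ∀ W : VField m N, dirDeriv W (e ∘ p) y
      = mfderiv (𝓡 k) 𝓘(ℝ, EuclideanSpace ℝ (Fin k)) e (p y) (mfderiv (𝓡 m) (𝓡 k) p y (W y)) := by
    intro y hy W
    rw [dirDeriv, mfderiv_comp y ((hes _ hy.2).mdifferentiableAt (by simp))
      ((hp y).mdifferentiableAt (by simp))]
    rfl
  have hYc : ContMDiffOn (𝓡 k) 𝓘(ℝ, EuclideanSpace ℝ (Fin k)) ∞ (dirDeriv Y e) e.source :=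
    contMDiffOn_dirDeriv (isOpen_extChartAt_source (p x)) (hY.mono (Set.subset_univ _))
      fun y hy => (hes y hy).contMDiffWithinAt
  have h1 := dirDeriv_bracket hOo (hA.mono Set.inter_subset_left) (hB.mono Set.inter_subset_left)
    hh hxO
  have h2 : dirDeriv A (dirDeriv B (e ∘ p)) x = 0 := by
    refine dirDeriv_const (c := 0) ?_ A
    filter_upwards [hOo.mem_nhds hxO] with y hy
    rw [hch y hy, hB0 y hy.1, map_zero]
    rfl
  -- Since A projects to Y, the function A(e ∘ p) is (Y e) ∘ p. It factors through p, so the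
  -- vertical field B annihilates it.
  have h3 : dirDeriv B (dirDeriv A (e ∘ p)) x = 0 := by
    rw [dirDeriv_congr (g := dirDeriv Y e ∘ p) ?_ B]
    · rw [dirDeriv, mfderiv_comp x ((hYc.contMDiffAt ((isOpen_extChartAt_source (p x)).mem_nhds
        hxO.2)).mdifferentiableAt (by simp)) ((hp x).mdifferentiableAt (by simp))]
      show mfderiv (𝓡 k) 𝓘(ℝ, EuclideanSpace ℝ (Fin k)) (dirDeriv Y e) (p x)
        (mfderiv (𝓡 m) (𝓡 k) p x (B x)) = 0
      rw [hB0 x hx, map_zero]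
    · filter_upwards [hOo.mem_nhds hxO] with y hy
      rw [hch y hy, hAY y hy.1]
      rfl
  rw [h2, h3, sub_zero, hch x hxO] at h1
  exact (isInvertible_mfderiv_extChartAt (I := 𝓡 k) hxO.2).injective (h1.trans (map_zero _).symm)

end Coordinates

/-! ### Clifford algebra identities for contractions and commutators -/

section CliffordSums

theorem sum_Ioi_eq_sum_ite {d : ℕ} {F : Type*} [AddCommMonoid F] (i : Fin d) (f : Fin d → F) :
    ∑ j ∈ Finset.Ioi i, f j = ∑ j, if i < j then f j else 0 := by
  rw [← Finset.sum_filter, Finset.filter_lt_eq_Ioi]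

/-- Splits a spin connection form in rank d + 1 into its rank d part and the pairs containing the
last frame vector. -/
theorem sum_sum_Ioi_castSucc {d : ℕ} {F : Type*} [AddCommMonoid F]
    (f : Fin (d + 1) → Fin (d + 1) → F) :
    ∑ i, ∑ j ∈ Finset.Ioi i, f i j
      = ∑ i : Fin d, ∑ j ∈ Finset.Ioi i, f i.castSucc j.castSucc
        + ∑ i : Fin d, f i.castSucc (Fin.last d) := by
  simp only [sum_Ioi_eq_sum_ite, Fin.sum_univ_castSucc, Fin.castSucc_lt_castSucc_iff,
    Fin.castSucc_lt_last, if_true, lt_irrefl, if_false, add_zero, Finset.sum_add_distrib]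
  rw [Finset.sum_eq_zero (f := fun j : Fin d => ite (Fin.last d < j.castSucc) _ _), add_zero]
  intro j _
  rw [if_neg (Fin.castSucc_lt_last j).not_gt]

variable {d : ℕ} {A : Type*} [Ring A] [Algebra ℝ A] {c : Fin d → A}

/-- A symmetric combination of products of Clifford generators is scalar. -/
theorem sum_symm_smul_mul (hc : ∀ k, c k * c k = -1) (hac : ∀ k l, k ≠ l → c k * c l = -(c l * c k))
    {s : Fin d → Fin d → ℝ} (hs : ∀ k l, s k l = s l k) :
    ∑ k, ∑ l, s k l • (c k * c l) = -(∑ k, s k k) • (1 : A) := by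
  have h1 : ∑ k, ∑ l, s k l • (c k * c l) = ∑ k, ∑ l, s k l • (c l * c k) := by
    rw [Finset.sum_comm]
    exact Finset.sum_congr rfl fun k _ => Finset.sum_congr rfl fun l _ => by rw [hs]
  -- Adding the transposed sum pairs c_k c_l with c_l c_k, so off-diagonal terms cancel and each
  -- diagonal term is counted twice.
  have h2 : ∑ k, ∑ l, s k l • (c k * c l) + ∑ k, ∑ l, s k l • (c k * c l)
      = (2 : ℝ) • (-(∑ k, s k k) • (1 : A)) := by
    conv_lhs => rhs; rw [h1]
    rw [← Finset.sum_add_distrib, smul_smul, mul_neg, neg_smul, Finset.mul_sum, Finset.sum_smul,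
      ← Finset.sum_neg_distrib]
    refine Finset.sum_congr rfl fun k _ => ?_
    rw [← Finset.sum_add_distrib, Finset.sum_eq_single k]
    · rw [hc, ← add_smul, smul_neg, two_mul]
    · intro l _ hl
      rw [hac k l hl.symm, smul_neg, neg_add_cancel]
    · simp
  rw [← two_smul ℝ] at h2
  exact smul_right_injective A (two_ne_zero (α := ℝ)) h2

/-- The Clifford relation c_a c_b = -c_b c_a - 2δ_{ab} is used twice to carry c_k leftwards past c_j
and then past c_i; the two δ-terms are what is left. -/
theorem commutator_mul_mul (hc : ∀ k, c k * c k = -1)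
    (hac : ∀ k l, k ≠ l → c k * c l = -(c l * c k)) (i j k : Fin d) :
    c i * c j * c k - c k * (c i * c j)
      = (if i = k then (2 : ℝ) • c j else 0) - (if j = k then (2 : ℝ) • c i else 0) := by
  have h : ∀ a b, c a * c b = -(c b * c a) - (if a = b then (2 : A) else 0) := by
    intro a b
    by_cases hab : a = b
    · subst hab; rw [if_pos rfl, hc]; norm_num
    · rw [if_neg hab, sub_zero, hac a b hab]
  have h1 : c i * c j * c k = -(c i * c k * c j) - c i * (if j = k then (2 : A) else 0) := by
    rw [mul_assoc, h j k]; noncomm_ring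
  rw [h1, h i k]
  split_ifs <;> (try simp only [two_smul]) <;> noncomm_ring

/-- The commutator of a Lie-algebra-valued coefficient `½ ∑_{i<j} w_{ij} c_i c_j` with `c_k`. -/
theorem commutator_spin (hc : ∀ k, c k * c k = -1)
    (hac : ∀ k l, k ≠ l → c k * c l = -(c l * c k)) {s : Fin d → Fin d → ℝ}
    (hs : ∀ i j, s i j = -s j i) (k : Fin d) :
    ((1 / 2 : ℝ) • ∑ i, ∑ j ∈ Finset.Ioi i, s i j • (c i * c j)) * c k
      - c k * ((1 / 2 : ℝ) • ∑ i, ∑ j ∈ Finset.Ioi i, s i j • (c i * c j))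
      = ∑ j, s k j • c j := by
  have hkk : s k k = 0 := by have := hs k k; linarith
  rw [smul_mul_assoc, mul_smul_comm, ← smul_sub]
  have h0 : (∑ i, ∑ j ∈ Finset.Ioi i, s i j • (c i * c j)) * c k
      - c k * (∑ i, ∑ j ∈ Finset.Ioi i, s i j • (c i * c j))
      = ∑ i, ∑ j ∈ Finset.Ioi i, s i j • (c i * c j * c k - c k * (c i * c j)) := by
    simp only [Finset.sum_mul, Finset.mul_sum, smul_mul_assoc, mul_smul_comm, smul_sub,
      Finset.sum_sub_distrib]
  rw [h0]
  simp only [commutator_mul_mul hc hac, sum_Ioi_eq_sum_ite]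
  have h1 : ∀ i j, (if i < j then s i j • ((if i = k then (2 : ℝ) • c j else 0)
        - (if j = k then (2 : ℝ) • c i else 0)) else 0)
      = (if i = k then (if i < j then s i j • (2 : ℝ) • c j else 0) else 0)
        - (if j = k then (if i < j then s i j • (2 : ℝ) • c i else 0) else 0) := by
    intro i j
    by_cases h1 : i < j
    · simp only [if_pos h1, smul_sub, smul_ite, smul_zero]
    · simp only [if_neg h1, ite_self, sub_zero]
  simp only [h1, Finset.sum_sub_distrib]
  rw [Finset.sum_comm]
  simp only [Finset.sum_ite_eq', Finset.mem_univ, if_true]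
  rw [← Finset.sum_sub_distrib, Finset.smul_sum]
  refine Finset.sum_congr rfl fun j _ => ?_
  -- Pairs starting with k supply the indices j > k, and pairs ending with k supply j < k.
  -- Antisymmetry of s gives them the same sign and kills j = k.
  rcases lt_trichotomy k j with h | h | h
  · rw [if_pos h, if_neg h.not_gt, sub_zero, smul_smul, smul_smul]; congr 1; ring
  · subst h; simp [hkk]
  · rw [if_neg h.not_gt, if_pos h, zero_sub, hs j k, neg_smul, neg_neg, smul_smul, smul_smul]
    congr 1; ring

end CliffordSums

/-! ### Generators acting on the spinor module -/

namespace SpinorModule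

variable {n : ℕ} {Sg : Type v} [NormedAddCommGroup Sg] [InnerProductSpace ℂ Sg]
  (R : SpinorModule n Sg)

/-- The rank 2^n is positive, which rules out the default value 0 of `finrank` in infinite
dimension. Clifford operators are then continuous. -/
theorem finiteDimensional (R : SpinorModule n Sg) : FiniteDimensional ℂ Sg :=
  FiniteDimensional.of_finrank_pos (by rw [R.finrank_eq]; positivity)

theorem oddRep_gam_castSucc (k : Fin (2 * n)) : R.oddRep (gam k.castSucc) = R.rho (gam k) := by
  rw [← clIncl_gam, R.oddRep_clIncl]

theorem oddRep_gam_last : R.oddRep (gam (Fin.last (2 * n))) = -Complex.I • R.chir := by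
  rw [oddRep, gam, vec, CliffordAlgebra.lift_ι_apply]
  have h : (fun k : Fin (2 * n) => (Pi.single (Fin.last (2 * n)) (1 : ℝ) : Fin (2 * n + 1) → ℝ)
      k.castSucc) = 0 := by
    funext k
    simp [(Fin.castSucc_lt_last k).ne]
  show R.rho (vec _) + _ = _
  rw [h, vec, map_zero, map_zero, zero_add, Pi.single_eq_same, one_smul]

theorem rho_gam_sq (k : Fin (2 * n)) : R.rho (gam k) * R.rho (gam k) = -1 := by
  rw [← map_mul, gam_sq, map_neg, map_one]

theorem rho_gam_anticomm (k l : Fin (2 * n)) (h : k ≠ l) :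
    R.rho (gam k) * R.rho (gam l) = -(R.rho (gam l) * R.rho (gam k)) := by
  rw [← map_mul, gam_anticomm h, map_neg, map_mul]

theorem chir_rho_gam (k : Fin (2 * n)) (s : Sg) :
    R.chir (R.rho (gam k) s) = -R.rho (gam k) (R.chir s) := by
  have h := LinearMap.congr_fun (R.rho_chir (Pi.single k 1)) s
  exact (neg_eq_iff_eq_neg.2 h).symm ▸ rfl

theorem skew_gam (k : Fin (2 * n)) (x y : Sg) :
    inner ℂ (R.rho (gam k) x) y = -inner ℂ x (R.rho (gam k) y) := R.skew _ x y

end SpinorModule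

/-! ### The Koszul formula in orthonormal frames -/

section KoszulConst

variable {m : ℕ} {N : Type u} [TopologicalSpace N] [ChartedSpace (EuclideanSpace ℝ (Fin m)) N]
  [IsManifold (𝓡 m) ∞ N]

omit [IsManifold (𝓡 m) ∞ N] in
/-- The Koszul formula for vector fields with constant inner products. -/
theorem lcPair_of_const {G : Tensor2 m N} {A B C : VField m N} {x : N} {r s q : ℝ}
    (hBC : ∀ᶠ y in nhds x, G y (B y) (C y) = r) (hAC : ∀ᶠ y in nhds x, G y (A y) (C y) = s)
    (hAB : ∀ᶠ y in nhds x, G y (A y) (B y) = q) :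
    lcPair G A B C x = (1 / 2 : ℝ) * (G x (bracket A B x) (C x) - G x (bracket A C x) (B x)
      - G x (bracket B C x) (A x)) := by
  rw [lcPair, dirDeriv_const hBC, dirDeriv_const hAC, dirDeriv_const hAB]
  ring

theorem SpinStructure.frame_const {d : ℕ} {V : ∀ x : N, Submodule ℝ (TangentSpace (𝓡 m) x)}
    {G : Tensor2 m N} (P : SpinStructure.{u, w} d V G) (a : P.index) {x : N} (hx : x ∈ P.dom a)
    (k l : Fin d) :
    ∀ᶠ y in nhds x, G y (P.frame a k y) (P.frame a l y) = if k = l then 1 else 0 := by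
  filter_upwards [(P.isOpen_dom a).mem_nhds hx] with y hy
  exact P.orthonormal a y hy k l

theorem SpinStructure.lcPair_frame {d : ℕ} {V : ∀ x : N, Submodule ℝ (TangentSpace (𝓡 m) x)}
    {G : Tensor2 m N} (P : SpinStructure.{u, w} d V G) (a : P.index) {x : N} (hx : x ∈ P.dom a)
    (i j k : Fin d) :
    lcPair G (P.frame a i) (P.frame a j) (P.frame a k) x
      = (1 / 2 : ℝ) * (G x (bracket (P.frame a i) (P.frame a j) x) (P.frame a k x)
        - G x (bracket (P.frame a i) (P.frame a k) x) (P.frame a j x)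
        - G x (bracket (P.frame a j) (P.frame a k) x) (P.frame a i x)) :=
  lcPair_of_const (P.frame_const a hx j k) (P.frame_const a hx i k) (P.frame_const a hx i j)

end KoszulConst

/-! ### Connection coefficients of the total space -/

namespace Fibration

variable {n : ℕ} {N : Type u} [TopologicalSpace N]
  [ChartedSpace (EuclideanSpace ℝ (Fin (2 * n + 1))) N] [IsManifold (𝓡 (2 * n + 1)) ∞ N]
variable {Sg : Type v} [NormedAddCommGroup Sg] [InnerProductSpace ℂ Sg]
variable (X : Fibration n N) (P : FiberSpin.{u, w} X)

theorem dp_bracket_frame (a : P.index) {x : N} (hx : x ∈ P.dom a) (k l : Fin (2 * n)) :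
    X.dp x (bracket (P.frame a k) (P.frame a l) x) = 0 := by
  -- A vertical field is projectable onto the zero field of the circle, so the bracket lemma applies
  -- with Y = 0.
  have h0 : SmoothVFieldOn (0 : VField 1 Circle) Set.univ :=
    (Bundle.contMDiff_zeroSection ℝ (TangentSpace (𝓡 1) : Circle → Type)).contMDiffOn
  exact mfderiv_bracket_eq_zero X.p_smooth (P.isOpen_dom a) (P.smooth_frame a k)
    (P.smooth_frame a l) h0 (fun y hy => X.dp_frame P a hy k) (fun y hy => X.dp_frame P a hy l) hx

variable (dth : X.UnitField)

theorem smooth_horLift : SmoothVFieldOn (X.horLift dth.field) Set.univ :=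
  X.lift_smooth dth.field dth.smooth

theorem dp_bracket_horLift (a : P.index) {x : N} (hx : x ∈ P.dom a) (k : Fin (2 * n)) :
    X.dp x (bracket (X.horLift dth.field) (P.frame a k) x) = 0 :=
  mfderiv_bracket_eq_zero X.p_smooth (P.isOpen_dom a)
    ((X.smooth_horLift dth).mono (Set.subset_univ _)) (P.smooth_frame a k) dth.smooth
    (fun _ _ => X.dp_horLift dth.field _) (fun _ hy => X.dp_frame P a hy k) hx

theorem bracket_smul_horLift (t : ℝ) (W : VField (2 * n + 1) N) (x : N) :
    bracket (fun y => t • X.horLift dth.field y) W x = t • bracket (X.horLift dth.field) W x :=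
  have : IsManifold (𝓡 (2 * n + 1)) (minSmoothness ℝ 2) N :=
    IsManifold.of_le minSmoothness_two_le
  VectorField.mlieBracket_const_smul_left
    (((X.smooth_horLift dth).contMDiffAt Filter.univ_mem).mdifferentiableAt (by simp))

/-- The metric pairing of a vertical vector with a horizontal one vanishes. -/
theorem metric_vert_hor (t : ℝ) {x : N} {w : TangentSpace (𝓡 (2 * n + 1)) x} (hw : X.dp x w = 0)
    (s : ℝ) : X.metric t x w (s • X.horLift dth.field x) = 0 := by
  rw [metric, hw, X.g_symm, show s • X.horLift dth.field x = X.lift x (s • dth.field (X.p x)) from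
      (map_smul (X.lift x) s _).symm, X.g_hor, map_zero]
  simp

theorem metric_vert (t : ℝ) {x : N} {w : TangentSpace (𝓡 (2 * n + 1)) x} (hw : X.dp x w = 0)
    (y : TangentSpace (𝓡 (2 * n + 1)) x) : X.metric t x w y = X.g x w y := by
  rw [metric, hw, map_zero]
  simp

/-- The mixed coefficient `g([∂̃_θ, e_k], e_l)`. -/
def mixed (a : P.index) (x : N) (k l : Fin (2 * n)) : ℝ :=
  X.g x (bracket (X.horLift dth.field) (P.frame a k) x) (P.frame a l x)

/-- Unit length of e_k kills the derivative term of the Lie derivative, and symmetry of g makes the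
two bracket terms equal. -/
theorem traceLie_eq (a : P.index) {x : N} (hx : x ∈ P.dom a) :
    X.traceLie P dth.field a x = -2 * ∑ k, X.mixed P dth a x k k := by
  rw [traceLie, Finset.mul_sum]
  refine Finset.sum_congr rfl fun k _ => ?_
  rw [lieDerivTensor, dirDeriv_const (P.frame_const a hx k k), mixed,
    show X.gTensor x (P.frame a k x) (bracket (X.horLift dth.field) (P.frame a k) x) = _ from
      X.g_symm x _ _]
  show 0 - X.g x _ _ - _ = _
  ring

variable {t : ℝ} (ht : 0 < t) (a : P.index) {x : N} (hx : x ∈ P.dom a)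
include ht hx

-- Brackets of vertical fields are vertical, and on them the base part of the metric contributes
-- nothing.
include dth in
theorem lcPair_total_vert (i j k : Fin (2 * n)) :
    lcPair (X.metric t) (P.frame a i) (P.frame a j) (P.frame a k) x
      = lcPair X.gTensor (P.frame a i) (P.frame a j) (P.frame a k) x := by
  have h := (X.totalSpin P dth t ht).lcPair_frame a hx i.castSucc j.castSucc k.castSucc
  simp only [totalSpin, totalFrame, Fin.snoc_castSucc] at h
  rw [h, P.lcPair_frame a hx, X.metric_vert t (X.dp_bracket_frame P a hx i j),
    X.metric_vert t (X.dp_bracket_frame P a hx i k), X.metric_vert t (X.dp_bracket_frame P a hx j k)]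
  rfl

/-- The second fundamental form of the fibers. Its symmetry comes from integrability of the vertical
bundle: the term with [e_i, e_j] is orthogonal to T. -/
theorem lcPair_total_vert_last (i j : Fin (2 * n)) :
    lcPair (X.metric t) (P.frame a i) (P.frame a j) (fun y => t • X.horLift dth.field y) x
      = (t / 2) * (X.mixed P dth a x i j + X.mixed P dth a x j i) := by
  have h := (X.totalSpin P dth t ht).lcPair_frame a hx i.castSucc j.castSucc (Fin.last _)
  simp only [totalSpin, totalFrame, Fin.snoc_castSucc, Fin.snoc_last] at h
  have hb : ∀ k, bracket (P.frame a k) (fun y => t • X.horLift dth.field y) x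
      = -(t • bracket (X.horLift dth.field) (P.frame a k) x) := fun k => by
    rw [bracket, VectorField.mlieBracket_swap_apply]
    exact congrArg Neg.neg (X.bracket_smul_horLift dth t _ x)
  have hm : ∀ k l, X.metric t x (-(t • bracket (X.horLift dth.field) (P.frame a k) x))
      (P.frame a l x) = -(t * X.mixed P dth a x k l) := fun k l => by
    rw [X.metric_vert t (by rw [map_neg, map_smul, X.dp_bracket_horLift P dth a hx, smul_zero,
      neg_zero]), map_neg, map_smul]
    rfl
  rw [h, hb, hb, hm, hm, X.metric_vert_hor dth t (X.dp_bracket_frame P a hx i j)]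
  ring

/-- Again [e_i, e_j] drops out, leaving an expression antisymmetric in i, j and linear in t. This
linearity lets the connection of the metric at t = 1 serve for every t. -/
theorem lcPair_total_last_vert (i j : Fin (2 * n)) :
    lcPair (X.metric t) (fun y => t • X.horLift dth.field y) (P.frame a i) (P.frame a j) x
      = (t / 2) * (X.mixed P dth a x i j - X.mixed P dth a x j i) := by
  have h := (X.totalSpin P dth t ht).lcPair_frame a hx (Fin.last _) i.castSucc j.castSucc
  simp only [totalSpin, totalFrame, Fin.snoc_castSucc, Fin.snoc_last] at h
  have hm : ∀ k l, X.metric t x (t • bracket (X.horLift dth.field) (P.frame a k) x)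
      (P.frame a l x) = t * X.mixed P dth a x k l := fun k l => by
    rw [X.metric_vert t (by rw [map_smul, X.dp_bracket_horLift P dth a hx, smul_zero]), map_smul]
    rfl
  rw [h, X.bracket_smul_horLift, X.bracket_smul_horLift, hm, hm,
    X.metric_vert_hor dth t (X.dp_bracket_frame P a hx i j)]
  ring

/-- Equivalently, ∇_T T has no vertical component: [T, e_i] is vertical and [T, T] = 0. Hence ∇_T on
spinors contains no Clifford multiplication by T. -/
theorem lcPair_total_last_vert_last (i : Fin (2 * n)) :
    lcPair (X.metric t) (fun y => t • X.horLift dth.field y) (P.frame a i)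
      (fun y => t • X.horLift dth.field y) x = 0 := by
  have h := (X.totalSpin P dth t ht).lcPair_frame a hx (Fin.last _) i.castSucc (Fin.last _)
  simp only [totalSpin, totalFrame, Fin.snoc_castSucc, Fin.snoc_last] at h
  have hv : X.dp x (bracket (fun y => t • X.horLift dth.field y) (P.frame a i) x) = 0 := by
    rw [X.bracket_smul_horLift, map_smul, X.dp_bracket_horLift P dth a hx, smul_zero]
  have hv' : X.dp x (bracket (P.frame a i) (fun y => t • X.horLift dth.field y) x) = 0 := by
    rw [bracket, VectorField.mlieBracket_swap_apply, map_neg]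
    exact neg_eq_zero.2 hv
  have hs : X.metric t x (bracket (fun y => t • X.horLift dth.field y)
      (fun y => t • X.horLift dth.field y) x) (P.frame a i x) = 0 := by
    rw [bracket, VectorField.mlieBracket_self]
    show X.metric t x 0 _ = 0
    rw [X.metric_vert t (map_zero _), map_zero]
    rfl
  rw [h, X.metric_vert_hor dth t hv, X.metric_vert_hor dth t hv', hs]
  ring

omit ht in
theorem lcPair_metric_one (i j : Fin (2 * n)) :
    lcPair (X.metric 1) (X.horLift dth.field) (P.frame a i) (P.frame a j) x
      = (1 / 2) * (X.mixed P dth a x i j - X.mixed P dth a x j i) := by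
  have h := X.lcPair_total_last_vert P dth one_pos a hx i j
  simpa only [one_smul] using h

end Fibration

/-! ### The Dirac operator of the total space -/

namespace Fibration

variable {n : ℕ} {N : Type u} [TopologicalSpace N]
  [ChartedSpace (EuclideanSpace ℝ (Fin (2 * n + 1))) N] [IsManifold (𝓡 (2 * n + 1)) ∞ N]
variable {Sg : Type v} [NormedAddCommGroup Sg] [InnerProductSpace ℂ Sg]
variable (X : Fibration n N) (P : FiberSpin.{u, w} X) (R : SpinorModule n Sg) (dth : X.UnitField)
  {t : ℝ} (ht : 0 < t) (φ : P.index → N → Sg) (a : P.index) {x : N} (hx : x ∈ P.dom a)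
include hx

/-- In the total space the covariant derivatives along the fibers acquire the terms with the
second fundamental form of the fibers. -/
theorem spinCov_total_vert (k : Fin (2 * n)) :
    (X.totalSpin P dth t ht).spinCov (X.metric t) R.oddRep (P.frame a k) φ a x
      = P.spinCov X.gTensor R.rho (P.frame a k) φ a x
        + ∑ i, (t / 4 * (X.mixed P dth a x k i + X.mixed P dth a x i k)) •
          R.rho (gam i) ((-Complex.I • R.chir) (φ a x)) := by
  unfold SpinStructure.spinCov
  rw [sum_sum_Ioi_castSucc, smul_add, ← add_assoc]
  simp only [totalSpin, totalFrame, Fin.snoc_castSucc, Fin.snoc_last, map_mul,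
    R.oddRep_gam_castSucc, R.oddRep_gam_last, X.lcPair_total_vert P dth ht a hx,
    X.lcPair_total_vert_last P dth ht a hx]
  congr 1
  rw [Finset.smul_sum]
  refine Finset.sum_congr rfl fun i _ => ?_
  rw [smul_smul]
  congr 1
  ring

/-- Derivative and connection form both scale by t, and the pairs containing T have zero
coefficient. -/
theorem spinCov_total_last :
    (X.totalSpin P dth t ht).spinCov (X.metric t) R.oddRep (fun y => t • X.horLift dth.field y) φ a x
      = t • P.spinCov (X.metric 1) R.rho (X.horLift dth.field) φ a x := by
  unfold SpinStructure.spinCov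
  rw [sum_sum_Ioi_castSucc]
  simp only [totalSpin, totalFrame, Fin.snoc_castSucc, Fin.snoc_last, map_mul,
    R.oddRep_gam_castSucc, R.oddRep_gam_last, X.lcPair_total_last_vert P dth ht a hx,
    X.lcPair_total_last_vert_last P dth ht a hx, X.lcPair_metric_one P dth a hx, zero_smul,
    Finset.sum_const_zero, add_zero]
  have h : dirDeriv (fun y => t • X.horLift dth.field y) (φ a) x
      = t • dirDeriv (X.horLift dth.field) (φ a) x :=
    map_smul (mfderiv (𝓡 (2 * n + 1)) 𝓘(ℝ, Sg) (φ a) x) t _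
  rw [h, smul_add]
  simp only [Finset.smul_sum, smul_smul]
  congr 1
  refine Finset.sum_congr rfl fun i _ => Finset.sum_congr rfl fun j _ => ?_
  congr 1
  ring

/-- The Dirac operator of the total space, in terms of the family of Dirac operators of the fibers
and of `∇̃`. -/
theorem delta_eq :
    X.delta P R dth t ht φ a x
      = X.fiberDirac P R φ a x
        + t • (-Complex.I • R.chir) (X.nablaTilde P R dth.field φ a x) := by
  have h1 : X.delta P R dth t ht φ a x
      = ∑ k : Fin (2 * n), R.rho (gam k)
          ((X.totalSpin P dth t ht).spinCov (X.metric t) R.oddRep (P.frame a k) φ a x)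
        + (-Complex.I • R.chir) ((X.totalSpin P dth t ht).spinCov (X.metric t) R.oddRep
            (fun y => t • X.horLift dth.field y) φ a x) := by
    unfold delta SpinStructure.dirac
    rw [Fin.sum_univ_castSucc]
    simp only [R.oddRep_gam_castSucc, R.oddRep_gam_last]
    simp only [totalSpin, totalFrame, Fin.snoc_castSucc, Fin.snoc_last]
  -- The second fundamental form enters as ∑ s_{ki} c_k c_i with s symmetric, hence only through its
  -- trace.
  have h2 := congrArg (fun L : Module.End ℂ Sg => L ((-Complex.I • R.chir) (φ a x)))
    (sum_symm_smul_mul R.rho_gam_sq R.rho_gam_anticomm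
      (s := fun k i => t / 4 * (X.mixed P dth a x k i + X.mixed P dth a x i k))
      (fun k i => by ring))
  simp only [LinearMap.sum_apply, LinearMap.smul_apply, Module.End.mul_apply,
    Module.End.one_apply] at h2
  rw [h1, X.spinCov_total_last P R dth ht φ a hx]
  simp only [X.spinCov_total_vert P R dth ht φ a hx, map_add, Finset.sum_add_distrib, map_sum,
    LinearMap.map_smul_of_tower]
  unfold fiberDirac SpinStructure.dirac nablaTilde
  rw [map_add, smul_add, add_assoc]
  congr 1
  rw [add_comm]
  congr 1
  have h3 : t • (-Complex.I • R.chir) ((1 / 4 * X.traceLie P dth.field a x) • φ a x)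
      = (t * (1 / 4 * X.traceLie P dth.field a x)) • (-Complex.I • R.chir) (φ a x) := by
    rw [LinearMap.map_smul_of_tower, smul_smul]
  -- Matching of constants: the contraction yields -(t/4) · 2 ∑ g([∂̃_θ, e_k], e_k), which is t · ¼
  -- tr(L g).
  rw [h3, X.traceLie_eq P dth a hx]
  simp only [LinearMap.smul_apply] at h2 ⊢
  refine h2.trans ?_
  congr 1
  rw [← Finset.mul_sum, Finset.sum_add_distrib]
  ring

end Fibration

/-! ### Determinants and traces in a moving orthonormal frame -/

section FrameDet

open Module

variable {m : ℕ}

/-- The determinant in the standard basis, as a continuous alternating form. -/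
def stdDet (m : ℕ) : EuclideanSpace ℝ (Fin m) [⋀^Fin m]→L[ℝ] ℝ where
  toAlternatingMap := (EuclideanSpace.basisFun (Fin m) ℝ).toBasis.det
  cont := by
    show Continuous fun v => (EuclideanSpace.basisFun (Fin m) ℝ).toBasis.det v
    simp only [Basis.det_apply]
    refine Continuous.matrix_det ?_
    refine continuous_matrix fun i j => ?_
    simp only [Basis.toMatrix_apply, OrthonormalBasis.coe_toBasis_repr_apply,
      EuclideanSpace.basisFun_repr]
    fun_prop

theorem stdDet_apply (v : Fin m → EuclideanSpace ℝ (Fin m)) :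
    stdDet m v = (Matrix.of fun i j => v j i).det := rfl

variable {B : EuclideanSpace ℝ (Fin m) →ₗ[ℝ] EuclideanSpace ℝ (Fin m) →ₗ[ℝ] ℝ}
  {e : Fin m → EuclideanSpace ℝ (Fin m)}

/-- Orthonormality reads Mᵀ G M = 1 for the matrix M of the frame and the Gram matrix G of the
standard basis; take determinants. -/
theorem det_gram_mul_stdDet_sq (he : ∀ i j, B (e i) (e j) = if i = j then 1 else 0) :
    (Matrix.of fun i j : Fin m => B (EuclideanSpace.single i 1) (EuclideanSpace.single j 1)).det
      * stdDet m e ^ 2 = 1 := by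
  set M : Matrix (Fin m) (Fin m) ℝ := Matrix.of fun i j => e j i with hM
  set G : Matrix (Fin m) (Fin m) ℝ :=
    Matrix.of fun i j : Fin m => B (EuclideanSpace.single i 1) (EuclideanSpace.single j 1) with hG
  have h : M.transpose * G * M = 1 := by
    ext k l
    have hx : ∀ k, e k = ∑ i, e k i • EuclideanSpace.single i (1 : ℝ) := fun k => by
      conv_lhs => rw [← (EuclideanSpace.basisFun (Fin m) ℝ).sum_repr (e k)]
      simp
    rw [Matrix.one_apply, ← he k l, hx k, hx l]
    simp only [Matrix.mul_apply, Matrix.transpose_apply, map_sum, map_smul, LinearMap.sum_apply,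
      LinearMap.smul_apply, smul_eq_mul, hM, hG, Matrix.of_apply, Finset.mul_sum, Finset.sum_mul]
    refine Finset.sum_congr rfl fun i _ => Finset.sum_congr rfl fun j _ => ?_
    ring
  have h2 := congrArg Matrix.det h
  rw [Matrix.det_mul, Matrix.det_mul, Matrix.det_transpose, Matrix.det_one] at h2
  rw [stdDet_apply, ← hM]
  linarith [h2, mul_comm M.det G.det]

theorem stdDet_ne_zero (he : ∀ i j, B (e i) (e j) = if i = j then 1 else 0) : stdDet m e ≠ 0 := by
  intro h
  have := det_gram_mul_stdDet_sq he
  simp [h] at this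

/-- Expresses the Riemannian density through the frame, so that its derivative can be computed from
those of the frame fields. -/
theorem sqrt_det_gram (he : ∀ i j, B (e i) (e j) = if i = j then 1 else 0) :
    √(Matrix.of fun i j : Fin m => B (EuclideanSpace.single i 1) (EuclideanSpace.single j 1)).det
      = |stdDet m e|⁻¹ := by
  have h := det_gram_mul_stdDet_sq he
  rw [eq_inv_of_mul_eq_one_left h, ← sq_abs, Real.sqrt_inv, Real.sqrt_sq (abs_nonneg _)]

theorem linearIndependent_of_orthonormal (he : ∀ i j, B (e i) (e j) = if i = j then 1 else 0) :
    LinearIndependent ℝ e := by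
  rw [Fintype.linearIndependent_iff]
  intro g hg i
  have := congrArg (fun x => B x (e i)) hg
  simpa [he] using this

/-- A frame which is orthonormal for a bilinear form, as a basis. -/
def orthoBasis (he : ∀ i j, B (e i) (e j) = if i = j then 1 else 0) :
    Basis (Fin m) ℝ (EuclideanSpace ℝ (Fin m)) :=
  basisOfLinearIndependentOfCardEqFinrank' e (linearIndependent_of_orthonormal he) (by simp)

theorem orthoBasis_apply (he : ∀ i j, B (e i) (e j) = if i = j then 1 else 0) (i : Fin m) :
    orthoBasis he i = e i := by
  simp [orthoBasis]

theorem orthoBasis_repr (he : ∀ i j, B (e i) (e j) = if i = j then 1 else 0) (i : Fin m)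
    (x : EuclideanSpace ℝ (Fin m)) : (orthoBasis he).repr x i = B x (e i) := by
  conv_rhs => rw [← (orthoBasis he).sum_repr x]
  simp [orthoBasis_apply, he]

/-- Expand the new vector in the frame: every component except the i-th repeats a vector and is
killed by alternation. -/
theorem stdDet_update (he : ∀ i j, B (e i) (e j) = if i = j then 1 else 0) (i : Fin m)
    (x : EuclideanSpace ℝ (Fin m)) :
    stdDet m (Function.update e i x) = B x (e i) * stdDet m e := by
  have h : ∀ y, stdDet m (Function.update e i y) = (stdDet m).toAlternatingMap
    (Function.update e i y) := fun _ => rfl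
  rw [h, ← (orthoBasis he).sum_repr x, AlternatingMap.map_update_sum, Finset.sum_eq_single i]
  · rw [AlternatingMap.map_update_smul, orthoBasis_apply, Function.update_eq_self,
      (orthoBasis he).sum_repr, orthoBasis_repr]
    rfl
  · intro j _ hj
    rw [AlternatingMap.map_update_smul, orthoBasis_apply, AlternatingMap.map_update_self _ _ hj.symm,
      smul_zero]
  · simp

theorem sum_pairing_eq_trace (he : ∀ i j, B (e i) (e j) = if i = j then 1 else 0)
    (L : EuclideanSpace ℝ (Fin m) →ₗ[ℝ] EuclideanSpace ℝ (Fin m)) :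
    ∑ i, B (L (e i)) (e i) = LinearMap.trace ℝ _ L := by
  rw [LinearMap.trace_eq_matrix_trace ℝ (orthoBasis he), Matrix.trace]
  refine Finset.sum_congr rfl fun i _ => ?_
  rw [Matrix.diag_apply, LinearMap.toMatrix_apply, orthoBasis_apply, orthoBasis_repr]

theorem trace_eq_sum_coord (L : EuclideanSpace ℝ (Fin m) →ₗ[ℝ] EuclideanSpace ℝ (Fin m)) :
    LinearMap.trace ℝ _ L = ∑ i, L (EuclideanSpace.single i 1) i := by
  rw [LinearMap.trace_eq_matrix_trace ℝ (EuclideanSpace.basisFun (Fin m) ℝ).toBasis, Matrix.trace]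
  refine Finset.sum_congr rfl fun i _ => ?_
  simp [LinearMap.toMatrix_apply]

/-- The derivative of the determinant of a moving frame. -/
theorem hasFDerivAt_stdDet {E : Fin m → EuclideanSpace ℝ (Fin m) → EuclideanSpace ℝ (Fin m)}
    {z : EuclideanSpace ℝ (Fin m)} (hE : ∀ k, DifferentiableAt ℝ (E k) z) :
    HasFDerivAt (fun y => stdDet m fun k => E k y)
      (((stdDet m).toContinuousMultilinearMap.linearDeriv fun k => E k z).comp
        (ContinuousLinearMap.pi fun k => fderiv ℝ (E k) z)) z :=
  ((stdDet m).hasFDerivAt (fun k => E k z)).comp z (hasFDerivAt_pi.2 fun k => (hE k).hasFDerivAt)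

theorem fderiv_stdDet {E : Fin m → EuclideanSpace ℝ (Fin m) → EuclideanSpace ℝ (Fin m)}
    {z : EuclideanSpace ℝ (Fin m)} (hE : ∀ k, DifferentiableAt ℝ (E k) z)
    (he : ∀ i j, B (E i z) (E j z) = if i = j then 1 else 0) (x : EuclideanSpace ℝ (Fin m)) :
    fderiv ℝ (fun y => stdDet m fun k => E k y) z x
      = (∑ k, B (fderiv ℝ (E k) z x) (E k z)) * stdDet m fun k => E k z := by
  rw [(hasFDerivAt_stdDet hE).fderiv, ContinuousLinearMap.comp_apply,
    ContinuousMultilinearMap.linearDeriv_apply, Finset.sum_mul]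
  exact Finset.sum_congr rfl fun k _ => stdDet_update he k _

end FrameDet

/-! ### The divergence theorem in Euclidean space -/

section Divergence

open MeasureTheory

variable {m : ℕ}

theorem integral_fderiv_eq_zero {f : EuclideanSpace ℝ (Fin m) → ℂ} (hf : ContDiff ℝ 1 f)
    (hc : HasCompactSupport f) (x : EuclideanSpace ℝ (Fin m)) :
    Integrable (fun z => fderiv ℝ f z x) ∧ ∫ z, fderiv ℝ f z x = 0 := by
  have hi : Integrable (fun z => fderiv ℝ f z x) :=
    (((hf.continuous_fderiv one_ne_zero).clm_apply continuous_const)).integrable_of_hasCompactSupport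
      (hc.fderiv_apply (𝕜 := ℝ) x)
  refine ⟨hi, ?_⟩
  -- Integration by parts against the constant function 1.
  have h := integral_mul_fderiv_eq_neg_fderiv_mul_of_integrable (𝕜 := ℂ) (μ := volume)
    (f := fun _ : EuclideanSpace ℝ (Fin m) => (1 : ℂ)) (g := f) (v := x)
    (by simp) (by simpa using hi)
    (by simpa using hf.continuous.integrable_of_hasCompactSupport hc)
    (fun _ _ => differentiableAt_const _) (fun z _ => hf.differentiable one_ne_zero z)
  simpa using h

/-- The divergence theorem for a compactly supported vector field `u W` on an open set. -/
theorem integral_div_eq_zero {Ω K : Set (EuclideanSpace ℝ (Fin m))} (hΩ : IsOpen Ω)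
    (hK : IsCompact K) (hKΩ : K ⊆ Ω) {u : EuclideanSpace ℝ (Fin m) → ℂ}
    {W : EuclideanSpace ℝ (Fin m) → EuclideanSpace ℝ (Fin m)}
    (hu : ∀ z ∈ Ω, ContDiffAt ℝ 1 u z) (hW : ∀ z ∈ Ω, ContDiffAt ℝ 1 W z)
    (hu0 : ∀ z ∈ Ω, z ∉ K → u z = 0) :
    IntegrableOn (fun z => fderiv ℝ u z (W z)
        + (LinearMap.trace ℝ _ (fderiv ℝ W z).toLinearMap : ℝ) * u z) Ω ∧
      ∫ z in Ω, (fderiv ℝ u z (W z)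
        + (LinearMap.trace ℝ _ (fderiv ℝ W z).toLinearMap : ℝ) * u z) = 0 := by
  classical
  -- The fields are controlled only on Ω. Their product components, extended by zero, are C¹
  -- everywhere because they vanish off the compact set K ⊆ Ω.
  set f : Fin m → EuclideanSpace ℝ (Fin m) → ℂ :=
    fun i => Ω.indicator fun z => (W z i : ℝ) * u z with hf
  have hf0 : ∀ i, ∀ z ∉ K, f i z = 0 := fun i z hz => by
    by_cases hzΩ : z ∈ Ω
    · simp [hf, hzΩ, hu0 z hzΩ hz]
    · simp [hf, hzΩ]
  have hfK : ∀ i, ∀ z ∉ K, f i =ᶠ[nhds z] fun _ => 0 := fun i z hz => by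
    filter_upwards [hK.isClosed.isOpen_compl.mem_nhds hz] with y hy using hf0 i y hy
  have hfΩ : ∀ i, ∀ z ∈ Ω, f i =ᶠ[nhds z] fun z => (W z i : ℝ) * u z := fun i z hz => by
    filter_upwards [hΩ.mem_nhds hz] with y hy
    simp [hf, hy]
  have hWi : ∀ i, ∀ z ∈ Ω, ContDiffAt ℝ 1 (fun z => ((W z i : ℝ) : ℂ)) z := fun i z hz =>
    (Complex.ofRealCLM.contDiff.comp (EuclideanSpace.proj (𝕜 := ℝ) i).contDiff).contDiffAt.comp z
      (hW z hz)
  have hfs : ∀ i, ContDiff ℝ 1 (f i) := fun i => contDiff_iff_contDiffAt.2 fun z => by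
    by_cases hz : z ∈ Ω
    · exact ((hWi i z hz).mul (hu z hz)).congr_of_eventuallyEq (hfΩ i z hz)
    · exact contDiffAt_const.congr_of_eventuallyEq (hfK i z fun h => hz (hKΩ h))
  have hfc : ∀ i, HasCompactSupport (f i) := fun i => HasCompactSupport.intro hK (hf0 i)
  have key : ∀ z, (∑ i, fderiv ℝ (f i) z (EuclideanSpace.single i 1))
      = Ω.indicator (fun z => fderiv ℝ u z (W z)
        + (LinearMap.trace ℝ _ (fderiv ℝ W z).toLinearMap : ℝ) * u z) z := fun z => by
    by_cases hz : z ∈ Ω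
    · rw [Set.indicator_of_mem hz, trace_eq_sum_coord]
      have hd : ∀ i, fderiv ℝ (fun z => ((W z i : ℝ) : ℂ)) z (EuclideanSpace.single i 1)
          = ((fderiv ℝ W z (EuclideanSpace.single i 1) i : ℝ) : ℂ) := fun i => by
        have h := ((Complex.ofRealCLM.comp (EuclideanSpace.proj (𝕜 := ℝ) i)).hasFDerivAt.comp z
          ((hW z hz).differentiableAt one_ne_zero).hasFDerivAt)
        exact congrArg (fun L => L (EuclideanSpace.single i 1)) h.fderiv
      have h1 : ∀ i, fderiv ℝ (f i) z (EuclideanSpace.single i 1)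
          = (W z i : ℝ) * fderiv ℝ u z (EuclideanSpace.single i 1)
            + (fderiv ℝ W z (EuclideanSpace.single i 1) i : ℝ) * u z := fun i => by
        rw [(hfΩ i z hz).fderiv_eq, fderiv_fun_mul ((hWi i z hz).differentiableAt one_ne_zero)
          ((hu z hz).differentiableAt one_ne_zero), ← hd]
        simp [mul_comm]
      have h2 : fderiv ℝ u z (W z)
          = ∑ i, (W z i : ℝ) * fderiv ℝ u z (EuclideanSpace.single i 1) := by
        conv_lhs => rw [← (EuclideanSpace.basisFun (Fin m) ℝ).sum_repr (W z)]
        simp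
      simp only [h1, Finset.sum_add_distrib, h2, Complex.ofReal_sum, Finset.sum_mul]
      rfl
    · rw [Set.indicator_of_notMem hz]
      refine Finset.sum_eq_zero fun i _ => ?_
      rw [(hfK i z fun h => hz (hKΩ h)).fderiv_eq]
      simp
  have hi := fun i => integral_fderiv_eq_zero (hfs i) (hfc i) (EuclideanSpace.single i 1)
  have hint : Integrable (fun z => ∑ i, fderiv ℝ (f i) z (EuclideanSpace.single i 1)) :=
    integrable_finsetSum _ fun i _ => (hi i).1
  have hsum : ∫ z, ∑ i, fderiv ℝ (f i) z (EuclideanSpace.single i 1) = 0 := by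
    rw [integral_finsetSum _ fun i _ => (hi i).1]
    exact Finset.sum_eq_zero fun i _ => (hi i).2
  simp only [key] at hint hsum
  exact ⟨(integrable_indicator_iff hΩ.measurableSet).1 hint,
    by rwa [integral_indicator hΩ.measurableSet] at hsum⟩

end Divergence

/-! ### The divergence theorem for the density of a frame -/

section FrameDivergence

open MeasureTheory

variable {m : ℕ}

/-- Covers both signs of the determinant, as a frame need not be positively oriented with respect to
the chart. -/
theorem hasDerivAt_abs_inv {x : ℝ} (hx : x ≠ 0) :
    HasDerivAt (fun y : ℝ => |y|⁻¹) (-(|x|⁻¹ * x⁻¹)) x := by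
  refine ((hasDerivAt_abs hx).inv (abs_ne_zero.2 hx)).congr_deriv ?_
  rcases hx.lt_or_gt with h | h
  · rw [abs_of_neg h]; simp [h]; field_simp
  · rw [abs_of_pos h]; simp [h]; field_simp

/-- The divergence theorem on an open set, for the density and the divergence given by a frame
which is orthonormal for a field of bilinear forms. -/
theorem integral_frame_div_eq_zero {Ω K : Set (EuclideanSpace ℝ (Fin m))} (hΩ : IsOpen Ω)
    (hK : IsCompact K) (hKΩ : K ⊆ Ω)
    {E : Fin m → EuclideanSpace ℝ (Fin m) → EuclideanSpace ℝ (Fin m)}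
    {B : EuclideanSpace ℝ (Fin m) →
      EuclideanSpace ℝ (Fin m) →ₗ[ℝ] EuclideanSpace ℝ (Fin m) →ₗ[ℝ] ℝ}
    (he : ∀ z ∈ Ω, ∀ i j, B z (E i z) (E j z) = if i = j then 1 else 0)
    (hE : ∀ z ∈ Ω, ∀ k, ContDiffAt ℝ 1 (E k) z)
    {W : EuclideanSpace ℝ (Fin m) → EuclideanSpace ℝ (Fin m)}
    (hW : ∀ z ∈ Ω, ContDiffAt ℝ 1 W z)
    {F : EuclideanSpace ℝ (Fin m) → ℂ} (hF : ∀ z ∈ Ω, ContDiffAt ℝ 1 F z)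
    (hF0 : ∀ z ∈ Ω, z ∉ K → F z = 0) :
    IntegrableOn (fun z => ((|stdDet m fun k => E k z|⁻¹ : ℝ) : ℂ) * (fderiv ℝ F z (W z)
        + (∑ k, B z (VectorField.lieBracket ℝ (E k) W z) (E k z) : ℝ) * F z)) Ω ∧
      ∫ z in Ω, ((|stdDet m fun k => E k z|⁻¹ : ℝ) : ℂ) * (fderiv ℝ F z (W z)
        + (∑ k, B z (VectorField.lieBracket ℝ (E k) W z) (E k z) : ℝ) * F z) = 0 := by
  set D : EuclideanSpace ℝ (Fin m) → ℝ := fun z => stdDet m fun k => E k z with hD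
  have hD0 : ∀ z ∈ Ω, D z ≠ 0 := fun z hz => stdDet_ne_zero (he z hz)
  have hDs : ∀ z ∈ Ω, ContDiffAt ℝ 1 D z := fun z hz =>
    ((stdDet m).toContinuousMultilinearMap.contDiff.contDiffAt).comp z
      (contDiffAt_pi.2 (hE z hz))
  have hρs : ∀ z ∈ Ω, ContDiffAt ℝ 1 (fun z => ((|D z|⁻¹ : ℝ) : ℂ)) z := fun z hz =>
    Complex.ofRealCLM.contDiff.contDiffAt.comp z
      (((contDiffAt_abs (hD0 z hz)).comp z (hDs z hz)).inv (abs_ne_zero.2 (hD0 z hz)))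
  have h := integral_div_eq_zero hΩ hK hKΩ (u := fun z => ((|D z|⁻¹ : ℝ) : ℂ) * F z) (W := W)
    (fun z hz => (hρs z hz).mul (hF z hz)) hW (fun z hz hzK => by simp [hF0 z hz hzK])
  have hcongr : ∀ z ∈ Ω, fderiv ℝ (fun z => ((|D z|⁻¹ : ℝ) : ℂ) * F z) z (W z)
        + (LinearMap.trace ℝ _ (fderiv ℝ W z).toLinearMap : ℝ) * (((|D z|⁻¹ : ℝ) : ℂ) * F z)
      = ((|D z|⁻¹ : ℝ) : ℂ) * (fderiv ℝ F z (W z)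
        + (∑ k, B z (VectorField.lieBracket ℝ (E k) W z) (E k z) : ℝ) * F z) := by
    intro z hz
    have hdE : ∀ k, DifferentiableAt ℝ (E k) z := fun k =>
      (hE z hz k).differentiableAt one_ne_zero
    have h1 : HasFDerivAt (fun z => ((|D z|⁻¹ : ℝ) : ℂ))
        (Complex.ofRealCLM.comp (-(|D z|⁻¹ * (D z)⁻¹) • fderiv ℝ D z)) z :=
      Complex.ofRealCLM.hasFDerivAt.comp z ((hasDerivAt_abs_inv (hD0 z hz)).comp_hasFDerivAt z
        ((hDs z hz).differentiableAt one_ne_zero).hasFDerivAt)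
    -- The bracket is DW(E_k) - DE_k(W); pairing its first part with E_k and summing gives the
    -- Euclidean divergence of W.
    have h2 : ∑ k, B z (VectorField.lieBracket ℝ (E k) W z) (E k z)
        = LinearMap.trace ℝ _ (fderiv ℝ W z).toLinearMap
          - ∑ k, B z (fderiv ℝ (E k) z (W z)) (E k z) := by
      rw [← sum_pairing_eq_trace (he z hz), ← Finset.sum_sub_distrib]
      refine Finset.sum_congr rfl fun k _ => ?_
      rw [VectorField.lieBracket, map_sub]
      rfl
    -- The other part is the logarithmic derivative of the frame determinant. It is minus that of
    -- the density, so the sum is the divergence of (density · F) W.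
    have h3 : fderiv ℝ D z (W z) = (∑ k, B z (fderiv ℝ (E k) z (W z)) (E k z)) * D z :=
      fderiv_stdDet hdE (he z hz) _
    rw [fderiv_fun_mul h1.differentiableAt ((hF z hz).differentiableAt one_ne_zero), h1.fderiv, h2]
    simp only [add_apply, smul_apply,
      ContinuousLinearMap.comp_apply, Complex.ofRealCLM_apply, smul_eq_mul, h3]
    rw [show -(|D z|⁻¹ * (D z)⁻¹) * ((∑ k, B z (fderiv ℝ (E k) z (W z)) (E k z)) * D z)
      = -(|D z|⁻¹ * (∑ k, B z (fderiv ℝ (E k) z (W z)) (E k z))) by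
        field_simp [hD0 z hz]]
    push_cast
    ring
  exact ⟨(integrableOn_congr_fun hcongr hΩ.measurableSet).1 h.1,
    (setIntegral_congr_fun hΩ.measurableSet hcongr).symm.trans h.2⟩

end FrameDivergence

/-! ### Skew-adjointness and the defect of self-adjointness at a point -/

namespace SpinorModule

variable {n : ℕ} {Sg : Type v} [NormedAddCommGroup Sg] [InnerProductSpace ℂ Sg]
  (R : SpinorModule n Sg)

/-- The connection form `½ ∑_{i<j} w_{ij} c(e_i) c(e_j)` of a spinor connection. -/
def spinEnd (s : Fin (2 * n) → Fin (2 * n) → ℝ) : Module.End ℂ Sg :=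
  (1 / 2 : ℝ) • ∑ i, ∑ j ∈ Finset.Ioi i, s i j • (R.rho (gam i) * R.rho (gam j))

theorem spinEnd_apply (s : Fin (2 * n) → Fin (2 * n) → ℝ) (x : Sg) :
    R.spinEnd s x
      = (1 / 2 : ℝ) • ∑ i, ∑ j ∈ Finset.Ioi i, s i j • R.rho (gam i * gam j) x := by
  simp only [spinEnd, LinearMap.smul_apply, LinearMap.sum_apply, map_mul]

theorem inner_real_smul_left_complex (r : ℝ) (x y : Sg) :
    inner ℂ (r • x) y = (r : ℂ) * inner ℂ x y := by
  rw [← Complex.coe_smul, inner_smul_left, Complex.conj_ofReal]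

theorem inner_real_smul_right_complex (r : ℝ) (x y : Sg) :
    inner ℂ x (r • y) = (r : ℂ) * inner ℂ x y := by
  rw [← Complex.coe_smul, inner_smul_right]

/-- Each c_i c_j with i ≠ j has adjoint c_j c_i = -c_i c_j, so the spin connection is compatible
with the Hermitian metric. -/
theorem spinEnd_skew (s : Fin (2 * n) → Fin (2 * n) → ℝ) (x y : Sg) :
    inner ℂ (R.spinEnd s x) y = -inner ℂ x (R.spinEnd s y) := by
  simp only [spinEnd_apply, inner_real_smul_left_complex, inner_real_smul_right_complex, sum_inner, inner_sum]
  rw [← mul_neg, ← Finset.sum_neg_distrib]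
  congr 1
  refine Finset.sum_congr rfl fun i _ => ?_
  rw [← Finset.sum_neg_distrib]
  refine Finset.sum_congr rfl fun j hj => ?_
  have hij : i ≠ j := (Finset.mem_Ioi.1 hj).ne
  rw [map_mul, Module.End.mul_apply, R.skew_gam, R.skew_gam, ← Module.End.mul_apply,
    R.rho_gam_anticomm j i hij.symm, LinearMap.neg_apply, inner_neg_right]
  ring

/-- The failure of formal self-adjointness of a Dirac operator, at a point. -/
theorem inner_dirac_sub (s : Fin (2 * n) → Fin (2 * n) → Fin (2 * n) → ℝ)
    (hs : ∀ k i j, s k i j = -s k j i) (p q : Fin (2 * n) → Sg) (x y : Sg) :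
    inner ℂ (∑ k, R.rho (gam k) (p k + R.spinEnd (s k) x)) y
        - inner ℂ x (∑ k, R.rho (gam k) (q k + R.spinEnd (s k) y))
      = -∑ j, (inner ℂ (p j) (R.rho (gam j) y) + inner ℂ x (R.rho (gam j) (q j))
        - (∑ k, s k k j : ℝ) * inner ℂ x (R.rho (gam j) y)) := by
  have h1 : ∀ k, inner ℂ (R.rho (gam k) (p k + R.spinEnd (s k) x)) y
      - inner ℂ x (R.rho (gam k) (q k + R.spinEnd (s k) y))
      = -(inner ℂ (p k) (R.rho (gam k) y) + inner ℂ x (R.rho (gam k) (q k)))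
        + ∑ j, (s k k j : ℂ) * inner ℂ x (R.rho (gam j) y) := by
    intro k
    -- Connection forms enter only through their commutator with c_k. This is again a vector, whose
    -- coefficients sum over k to the divergence terms.
    have h2 : inner ℂ x (R.spinEnd (s k) (R.rho (gam k) y))
        - inner ℂ x (R.rho (gam k) (R.spinEnd (s k) y))
        = ∑ j, (s k k j : ℂ) * inner ℂ x (R.rho (gam j) y) := by
      have h3 := LinearMap.congr_fun
        (commutator_spin R.rho_gam_sq R.rho_gam_anticomm (hs k) k) y
      rw [← inner_sub_right]
      refine (congrArg (inner ℂ x) h3).trans ?_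
      simp only [LinearMap.sum_apply, LinearMap.smul_apply, inner_sum, inner_real_smul_right_complex]
    rw [← h2, R.skew_gam, inner_add_left, R.spinEnd_skew, map_add, inner_add_right]
    ring
  rw [sum_inner, inner_sum, ← Finset.sum_sub_distrib, Finset.sum_congr rfl fun k _ => h1 k,
    Finset.sum_add_distrib, Finset.sum_comm, ← Finset.sum_add_distrib, ← Finset.sum_neg_distrib]
  refine Finset.sum_congr rfl fun j _ => ?_
  rw [← Finset.sum_mul]
  push_cast
  ring

/-- An endomorphism of the spinor module, as a continuous real-linear map. -/
def toCLM (R : SpinorModule n Sg) (L : Module.End ℂ Sg) : Sg →L[ℝ] Sg :=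
  have := R.finiteDimensional
  (LinearMap.toContinuousLinearMap L).restrictScalars ℝ

theorem toCLM_apply (L : Module.End ℂ Sg) (x : Sg) : R.toCLM L x = L x := rfl

end SpinorModule

/-! ### Metric, volume and divergence of the total space in a chart -/

namespace Fibration

variable {n : ℕ} {N : Type u} [TopologicalSpace N]
  [ChartedSpace (EuclideanSpace ℝ (Fin (2 * n + 1))) N] [IsManifold (𝓡 (2 * n + 1)) ∞ N]
variable {Sg : Type v} [NormedAddCommGroup Sg] [InnerProductSpace ℂ Sg]
variable (X : Fibration n N) (P : FiberSpin.{u, w} X) (R : SpinorModule n Sg) (dth : X.UnitField)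
  (t : ℝ)

/-- The metric of the total space at a point, as a bilinear form. -/
def metricForm (x : N) :
    TangentSpace (𝓡 (2 * n + 1)) x →ₗ[ℝ] TangentSpace (𝓡 (2 * n + 1)) x →ₗ[ℝ] ℝ :=
  LinearMap.mk₂ ℝ (X.metric t x)
    (fun u u' w => by simp only [metric, map_add, add_apply]; ring)
    (fun c u w => by simp only [metric, map_smul, smul_apply, smul_eq_mul]; ring)
    (fun u w w' => by simp only [metric, map_add]; ring)
    (fun c u w => by simp only [metric, map_smul, smul_eq_mul]; ring)

/-- The metric of the total space in the chart at `x₀`. -/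
def coordMetric (x₀ : N) (z : EuclideanSpace ℝ (Fin (2 * n + 1))) :
    EuclideanSpace ℝ (Fin (2 * n + 1)) →ₗ[ℝ] EuclideanSpace ℝ (Fin (2 * n + 1)) →ₗ[ℝ] ℝ :=
  let T : EuclideanSpace ℝ (Fin (2 * n + 1)) →L[ℝ]
      TangentSpace (𝓡 (2 * n + 1)) ((extChartAt (𝓡 (2 * n + 1)) x₀).symm z) :=
    mfderiv 𝓘(ℝ, EuclideanSpace ℝ (Fin (2 * n + 1))) (𝓡 (2 * n + 1))
      (extChartAt (𝓡 (2 * n + 1)) x₀).symm z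
  (X.metricForm t ((extChartAt (𝓡 (2 * n + 1)) x₀).symm z)).compl₁₂ T.toLinearMap T.toLinearMap

theorem coordMetric_apply (x₀ : N) (z u w : EuclideanSpace ℝ (Fin (2 * n + 1))) :
    X.coordMetric t x₀ z u w = X.metric t ((extChartAt (𝓡 (2 * n + 1)) x₀).symm z)
      (mfderiv 𝓘(ℝ, EuclideanSpace ℝ (Fin (2 * n + 1))) (𝓡 (2 * n + 1))
        (extChartAt (𝓡 (2 * n + 1)) x₀).symm z u)
      (mfderiv 𝓘(ℝ, EuclideanSpace ℝ (Fin (2 * n + 1))) (𝓡 (2 * n + 1))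
        (extChartAt (𝓡 (2 * n + 1)) x₀).symm z w) := rfl

variable {t} (ht : 0 < t) (a : P.index) (x₀ : N)
  {z : EuclideanSpace ℝ (Fin (2 * n + 1))} (hz : z ∈ (extChartAt (𝓡 (2 * n + 1)) x₀).target)
  (hza : (extChartAt (𝓡 (2 * n + 1)) x₀).symm z ∈ P.dom a)
include ht hz hza

theorem coordMetric_frame (i j : Fin (2 * n + 1)) :
    X.coordMetric t x₀ z (coordField x₀ (X.totalFrame P dth t a i) z)
      (coordField x₀ (X.totalFrame P dth t a j) z) = if i = j then 1 else 0 := by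
  rw [coordMetric_apply, mfderiv_chart_symm_coordField hz, mfderiv_chart_symm_coordField hz]
  exact (X.totalSpin P dth t ht).orthonormal a _ hza i j

theorem volDensity_metric :
    volDensity (X.metric t) x₀ z
      = |stdDet _ fun k => coordField x₀ (X.totalFrame P dth t a k) z|⁻¹ :=
  sqrt_det_gram (X.coordMetric_frame P dth ht a x₀ hz hza)

/-- The divergence of a vertical frame field for the metric of the total space is its divergence
in the fibers. -/
theorem sum_coordMetric_lieBracket (j : Fin (2 * n)) :
    ∑ k, X.coordMetric t x₀ z (VectorField.lieBracket ℝ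
        (coordField x₀ (X.totalFrame P dth t a k)) (coordField x₀ (P.frame a j)) z)
        (coordField x₀ (X.totalFrame P dth t a k) z)
      = -∑ k, lcPair X.gTensor (P.frame a k) (P.frame a k) (P.frame a j)
          ((extChartAt (𝓡 (2 * n + 1)) x₀).symm z) := by
  have h : ∀ k, X.coordMetric t x₀ z (VectorField.lieBracket ℝ
        (coordField x₀ (X.totalFrame P dth t a k)) (coordField x₀ (P.frame a j)) z)
        (coordField x₀ (X.totalFrame P dth t a k) z)
      = X.metric t ((extChartAt (𝓡 (2 * n + 1)) x₀).symm z)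
        (bracket (X.totalFrame P dth t a k) (P.frame a j) _)
        (X.totalFrame P dth t a k ((extChartAt (𝓡 (2 * n + 1)) x₀).symm z)) := fun k => by
    rw [coordMetric_apply, mfderiv_chart_symm_coordField hz]
    exact congrArg (fun v => X.metric t _ v _) (mfderiv_chart_symm_lieBracket (P.isOpen_dom a)
      ((X.totalSpin P dth t ht).smooth_frame a k) (P.smooth_frame a j) hz hza)
  simp only [h]
  rw [Fin.sum_univ_castSucc]
  simp only [totalFrame, Fin.snoc_castSucc, Fin.snoc_last]
  rw [X.metric_vert_hor dth t, add_zero, ← Finset.sum_neg_distrib]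
  -- With [e_k, e_k] = 0 the two remaining Koszul terms coincide and cancel the factor ½.
  · refine Finset.sum_congr rfl fun k _ => ?_
    rw [X.metric_vert t (X.dp_bracket_frame P a hza k j), P.lcPair_frame a hza,
      show bracket (P.frame a k) (P.frame a k) _ = 0 from congrFun VectorField.mlieBracket_self _]
    show _ = -(1 / 2 * (X.g _ 0 _ - X.g _ _ _ - X.g _ _ _))
    rw [map_zero]
    show _ = -(1 / 2 * (0 - X.g _ _ _ - X.g _ _ _))
    ring
  -- The T-component of the divergence vanishes because [T, e_j] is vertical.
  · rw [X.bracket_smul_horLift, map_smul, X.dp_bracket_horLift P dth a hza, smul_zero]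

end Fibration

/-- Integrability of f and g need not be known: as h is integrable, f and g are integrable together,
and otherwise both integrals are 0 by convention. -/
theorem setIntegral_eq_of_sub_eq {α : Type*} [MeasurableSpace α] {μ : MeasureTheory.Measure α}
    {s : Set α} (hs : MeasurableSet s) {f g h : α → ℂ} (hfg : ∀ z ∈ s, f z = g z + h z)
    (hh : MeasureTheory.IntegrableOn h s μ) (h0 : ∫ z in s, h z ∂μ = 0) :
    ∫ z in s, f z ∂μ = ∫ z in s, g z ∂μ := by
  rw [MeasureTheory.setIntegral_congr_fun hs hfg]
  by_cases hg : MeasureTheory.IntegrableOn g s μ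
  · rw [MeasureTheory.integral_add hg hh, h0, add_zero]
  · rw [MeasureTheory.integral_undef hg, MeasureTheory.integral_undef]
    intro hgh
    exact hg ((hgh.sub hh).congr (MeasureTheory.ae_of_all _ fun z => add_sub_cancel_right _ _))

/-! ### Formal self-adjointness of the fiber Dirac operators -/

namespace Fibration

variable {n : ℕ} {N : Type u} [TopologicalSpace N]
  [ChartedSpace (EuclideanSpace ℝ (Fin (2 * n + 1))) N] [IsManifold (𝓡 (2 * n + 1)) ∞ N]
variable {Sg : Type v} [NormedAddCommGroup Sg] [InnerProductSpace ℂ Sg]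
variable (X : Fibration n N) (P : FiberSpin.{u, w} X) (R : SpinorModule n Sg) (dth : X.UnitField)

/-- Metric compatibility of the connection, visible in the bracket form of the Koszul formula. -/
theorem lcPair_frame_antisymm (a : P.index) {x : N} (hx : x ∈ P.dom a) (k i j : Fin (2 * n)) :
    lcPair X.gTensor (P.frame a k) (P.frame a i) (P.frame a j) x
      = -lcPair X.gTensor (P.frame a k) (P.frame a j) (P.frame a i) x := by
  have h : X.gTensor x (bracket (P.frame a j) (P.frame a i) x) (P.frame a k x)
      = -X.gTensor x (bracket (P.frame a i) (P.frame a j) x) (P.frame a k x) := by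
    rw [bracket, VectorField.mlieBracket_swap_apply]
    show X.g x (-_) _ = -X.g x _ _
    rw [map_neg]
    rfl
  rw [P.lcPair_frame a hx, P.lcPair_frame a hx, h]
  ring

theorem fiberDirac_eq (φ : P.index → N → Sg) (a : P.index) (x : N) :
    X.fiberDirac P R φ a x = ∑ k, R.rho (gam k) (dirDeriv (P.frame a k) (φ a) x
      + R.spinEnd (fun i j => lcPair X.gTensor (P.frame a k) (P.frame a i) (P.frame a j) x)
          (φ a x)) := by
  simp only [fiberDirac, SpinStructure.dirac, SpinStructure.spinCov, R.spinEnd_apply]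

theorem mdifferentiableAt_spinor {φ : P.index → N → Sg} (hφ : P.IsSpinor R.rho φ) (a : P.index)
    {x : N} (hx : x ∈ P.dom a) : MDifferentiableAt (𝓡 (2 * n + 1)) 𝓘(ℝ, Sg) (φ a) x :=
  ((hφ.smooth a).contMDiffAt ((P.isOpen_dom a).mem_nhds hx)).mdifferentiableAt (by simp)

/-- The Dirac operators of the fibers are formally self-adjoint up to a total divergence. -/
theorem inner_fiberDirac_sub {φ ψ : P.index → N → Sg} (hφ : P.IsSpinor R.rho φ)
    (hψ : P.IsSpinor R.rho ψ) {t : ℝ} (ht : 0 < t) (a : P.index) (x₀ : N)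
    {z : EuclideanSpace ℝ (Fin (2 * n + 1))} (hz : z ∈ (extChartAt (𝓡 (2 * n + 1)) x₀).target)
    (hza : (extChartAt (𝓡 (2 * n + 1)) x₀).symm z ∈ P.dom a) :
    inner ℂ (X.fiberDirac P R φ a ((extChartAt (𝓡 (2 * n + 1)) x₀).symm z))
          (ψ a ((extChartAt (𝓡 (2 * n + 1)) x₀).symm z))
        - inner ℂ (φ a ((extChartAt (𝓡 (2 * n + 1)) x₀).symm z))
          (X.fiberDirac P R ψ a ((extChartAt (𝓡 (2 * n + 1)) x₀).symm z))
      = -∑ j, (fderiv ℝ (fun y => inner ℂ (φ a ((extChartAt (𝓡 (2 * n + 1)) x₀).symm y))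
            (R.rho (gam j) (ψ a ((extChartAt (𝓡 (2 * n + 1)) x₀).symm y)))) z
              (coordField x₀ (P.frame a j) z)
          + (∑ k, X.coordMetric t x₀ z (VectorField.lieBracket ℝ
              (coordField x₀ (X.totalFrame P dth t a k)) (coordField x₀ (P.frame a j)) z)
              (coordField x₀ (X.totalFrame P dth t a k) z) : ℝ)
            * inner ℂ (φ a ((extChartAt (𝓡 (2 * n + 1)) x₀).symm z))
              (R.rho (gam j) (ψ a ((extChartAt (𝓡 (2 * n + 1)) x₀).symm z)))) := by
  set e := extChartAt (𝓡 (2 * n + 1)) x₀ with he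
  rw [fiberDirac_eq, fiberDirac_eq, R.inner_dirac_sub _ fun k i j =>
    X.lcPair_frame_antisymm P a hza k i j]
  congr 1
  refine Finset.sum_congr rfl fun j _ => ?_
  have hφd : DifferentiableAt ℝ (φ a ∘ e.symm) z :=
    (contDiffAt_comp_chart_symm (P.isOpen_dom a) (hφ.smooth a) hz hza).differentiableAt (by simp)
  have hψd : DifferentiableAt ℝ (ψ a ∘ e.symm) z :=
    (contDiffAt_comp_chart_symm (P.isOpen_dom a) (hψ.smooth a) hz hza).differentiableAt (by simp)
  have hcψ : HasFDerivAt (fun y => R.rho (gam j) (ψ a (e.symm y)))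
      ((R.toCLM (R.rho (gam j))).comp (fderiv ℝ (ψ a ∘ e.symm) z)) z :=
    (R.toCLM (R.rho (gam j))).hasFDerivAt.comp z hψd.hasFDerivAt
  -- Clifford multiplication by e_j is constant in a spin frame, so the product rule differentiates
  -- only φ and ψ.
  have h1 := fderiv_inner_apply ℂ hφd hcψ.differentiableAt (coordField x₀ (P.frame a j) z)
  rw [hcψ.fderiv, ContinuousLinearMap.comp_apply, R.toCLM_apply,
    ← dirDeriv_coord hz (P.frame a j) (mdifferentiableAt_spinor X P R hφ a hza),
    ← dirDeriv_coord hz (P.frame a j) (mdifferentiableAt_spinor X P R hψ a hza)] at h1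
  rw [X.sum_coordMetric_lieBracket P dth ht a x₀ hz hza j]
  refine Eq.trans ?_ (congrArg (· + _) h1.symm)
  simp only [Function.comp_apply]
  push_cast
  ring

include dth in
/-- The family of Dirac operators of the fibers is its own formal adjoint, for the volume of the
total space. -/
theorem isFormalAdjoint_fiberDirac {t : ℝ} (ht : 0 < t) :
    X.IsFormalAdjoint P R (X.metric t) (X.fiberDirac P R) (X.fiberDirac P R) := by
  intro φ ψ hφ hψ a x₀ K hK hKs hφ0 e
  set Ω : Set (EuclideanSpace ℝ (Fin (2 * n + 1))) := e.target ∩ e.symm ⁻¹' P.dom a with hΩ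
  have hΩo : IsOpen Ω := (continuousOn_extChartAt_symm x₀).isOpen_inter_preimage
    (isOpen_extChartAt_target x₀) (P.isOpen_dom a)
  have hKc : IsCompact (e '' K) := hK.image_of_continuousOn
    ((continuousOn_extChartAt x₀).mono fun x hx => (hKs hx).2)
  have hKΩ : e '' K ⊆ Ω := by
    rintro _ ⟨x, hx, rfl⟩
    refine ⟨e.map_source (hKs hx).2, ?_⟩
    rw [Set.mem_preimage, e.left_inv (hKs hx).2]
    exact (hKs hx).1
  have hs : ∀ {χ : P.index → N → Sg}, P.IsSpinor R.rho χ → ∀ z ∈ Ω,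
      ContDiffAt ℝ 1 (χ a ∘ e.symm) z := fun hχ z hz =>
    (contDiffAt_comp_chart_symm (P.isOpen_dom a) (hχ.smooth a) hz.1 hz.2).of_le (by simp)
  -- The divergence theorem is applied to each field ⟨φ, c(e_j)ψ⟩ e_j; the support of φ keeps it
  -- inside the image of K.
  have hdiv := fun j : Fin (2 * n) => integral_frame_div_eq_zero hΩo hKc hKΩ
    (E := fun k => coordField x₀ (X.totalFrame P dth t a k))
    (B := X.coordMetric t x₀)
    (fun z hz => X.coordMetric_frame P dth ht a x₀ hz.1 hz.2)
    (fun z hz k => (contDiffAt_coordField (P.isOpen_dom a)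
      ((X.totalSpin P dth t ht).smooth_frame a k) hz.1 hz.2).of_le (by simp))
    (W := coordField x₀ (P.frame a j))
    (fun z hz => (contDiffAt_coordField (P.isOpen_dom a) (P.smooth_frame a j) hz.1 hz.2).of_le
      (by simp))
    (F := fun z => inner ℂ (φ a (e.symm z)) (R.rho (gam j) (ψ a (e.symm z))))
    (fun z hz => (hs hφ.1 z hz).inner ℂ
      ((R.toCLM (R.rho (gam j))).contDiff.contDiffAt.comp z (hs hψ.1 z hz)))
    (fun z hz hzK => by
      rw [hφ0 a _ hz.2 fun h => hzK ⟨_, h, e.right_inv hz.1⟩, inner_zero_left])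
  refine setIntegral_eq_of_sub_eq hΩo.measurableSet (fun z hz => ?_)
    (MeasureTheory.integrable_finsetSum Finset.univ fun j _ => (hdiv j).1).neg ?_
  · have h := X.inner_fiberDirac_sub P R dth hφ.1 hψ.1 ht a x₀
      hz.1 hz.2
    rw [X.volDensity_metric P dth ht a x₀ hz.1 hz.2,
      sub_eq_iff_eq_add.1 h, mul_add, add_comm, mul_neg, Finset.mul_sum]
    rfl
  · rw [MeasureTheory.integral_neg', MeasureTheory.integral_finsetSum _ fun j _ => (hdiv j).1,
      Finset.sum_eq_zero fun j _ => (hdiv j).2, neg_zero]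

end Fibration

/-! ### Additivity and chirality of the operators -/

namespace Fibration

variable {n : ℕ} {N : Type u} [TopologicalSpace N]
  [ChartedSpace (EuclideanSpace ℝ (Fin (2 * n + 1))) N] [IsManifold (𝓡 (2 * n + 1)) ∞ N]
variable {Sg : Type v} [NormedAddCommGroup Sg] [InnerProductSpace ℂ Sg]
variable (X : Fibration n N) (P : FiberSpin.{u, w} X) (R : SpinorModule n Sg)

theorem isOpen_dom_eventually (a : P.index) {x : N} (hx : x ∈ P.dom a) :
    ∀ᶠ y in nhds x, y ∈ P.dom a := (P.isOpen_dom a).mem_nhds hx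

omit [IsManifold (𝓡 (2 * n + 1)) ∞ N] in
theorem dirDeriv_clm (L : Sg →L[ℝ] Sg) {f : N → Sg} {x : N}
    (hf : MDifferentiableAt (𝓡 (2 * n + 1)) 𝓘(ℝ, Sg) f x) (W : VField (2 * n + 1) N) :
    dirDeriv W (fun y => L (f y)) x = L (dirDeriv W f x) := by
  have h := mfderiv_comp x (L.differentiableAt (x := f x)).mdifferentiableAt hf
  rw [mfderiv_eq_fderiv, L.fderiv] at h
  exact congrArg (fun T => T (W x)) h

omit [IsManifold (𝓡 (2 * n + 1)) ∞ N] in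
theorem dirDeriv_add {f g : N → Sg} {x : N}
    (hf : MDifferentiableAt (𝓡 (2 * n + 1)) 𝓘(ℝ, Sg) f x)
    (hg : MDifferentiableAt (𝓡 (2 * n + 1)) 𝓘(ℝ, Sg) g x) (W : VField (2 * n + 1) N) :
    dirDeriv W (f + g) x = dirDeriv W f x + dirDeriv W g x := by
  rw [dirDeriv, mfderiv_add hf hg]
  rfl

-- Chirality is a constant operator in a spin frame, so the eigenvalue equation can be
-- differentiated.
omit [IsManifold (𝓡 (2 * n + 1)) ∞ N] in
theorem chir_dirDeriv {f : N → Sg} {x : N} {r : ℝ}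
    (hf : MDifferentiableAt (𝓡 (2 * n + 1)) 𝓘(ℝ, Sg) f x)
    (h : ∀ᶠ y in nhds x, R.chir (f y) = r • f y) (W : VField (2 * n + 1) N) :
    R.chir (dirDeriv W f x) = r • dirDeriv W f x := by
  have h1 := dirDeriv_clm (R.toCLM R.chir) hf W
  have h2 := dirDeriv_clm (r • ContinuousLinearMap.id ℝ Sg) hf W
  exact h1.symm.trans ((dirDeriv_congr h W).trans h2)

variable {φ ψ : P.index → N → Sg} (hφ : P.IsSpinor R.rho φ) (hψ : P.IsSpinor R.rho ψ)
  (a : P.index) {x : N} (hx : x ∈ P.dom a)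
include hφ hx

theorem spinCov_add (hψ : P.IsSpinor R.rho ψ) (G : Tensor2 (2 * n + 1) N)
    (W : VField (2 * n + 1) N) :
    P.spinCov G R.rho W (φ + ψ) a x = P.spinCov G R.rho W φ a x + P.spinCov G R.rho W ψ a x := by
  have h := dirDeriv_add (mdifferentiableAt_spinor X P R hφ a hx)
    (mdifferentiableAt_spinor X P R hψ a hx) W
  simp only [SpinStructure.spinCov, Pi.add_apply, map_add, smul_add, Finset.sum_add_distrib, h]
  abel

theorem fiberDirac_add (hψ : P.IsSpinor R.rho ψ) :
    X.fiberDirac P R (φ + ψ) a x = X.fiberDirac P R φ a x + X.fiberDirac P R ψ a x := by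
  simp only [fiberDirac, SpinStructure.dirac, X.spinCov_add P R hφ a hx hψ, map_add,
    Finset.sum_add_distrib]

theorem nablaTilde_add (hψ : P.IsSpinor R.rho ψ) (Y : VField 1 Circle) :
    X.nablaTilde P R Y (φ + ψ) a x = X.nablaTilde P R Y φ a x + X.nablaTilde P R Y ψ a x := by
  simp only [nablaTilde, X.spinCov_add P R hφ a hx hψ, Pi.add_apply, smul_add]
  abel

variable {r : ℝ} (hr : ∀ y ∈ P.dom a, R.chir (φ a y) = r • φ a y)
include hr

/-- Chirality commutes with the even products c_i c_j of the connection form. Keeping r general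
treats S^+ and S^- together. -/
theorem chir_spinCov (G : Tensor2 (2 * n + 1) N) (W : VField (2 * n + 1) N) :
    R.chir (P.spinCov G R.rho W φ a x) = r • P.spinCov G R.rho W φ a x := by
  have h := chir_dirDeriv R (mdifferentiableAt_spinor X P R hφ a hx)
    ((isOpen_dom_eventually X P a hx).mono hr) W
  simp only [SpinStructure.spinCov, map_add, LinearMap.map_smul_of_tower, map_sum, map_mul,
    Module.End.mul_apply, R.chir_rho_gam, map_neg, neg_neg, hr x hx, h, smul_add]
  congr 1
  rw [smul_comm r]
  simp only [Finset.smul_sum, smul_comm r]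

theorem chir_nablaTilde (Y : VField 1 Circle) :
    R.chir (X.nablaTilde P R Y φ a x) = r • X.nablaTilde P R Y φ a x := by
  simp only [nablaTilde, map_add, LinearMap.map_smul_of_tower, smul_add,
    X.chir_spinCov P R hφ a hx hr, hr x hx]
  rw [smul_comm r]

/-- The single extra factor c(e_k) anticommutes with chirality. -/
theorem chir_fiberDirac : R.chir (X.fiberDirac P R φ a x) = -(r • X.fiberDirac P R φ a x) := by
  simp only [fiberDirac, SpinStructure.dirac, map_sum, R.chir_rho_gam, X.chir_spinCov P R hφ a hx hr,
    LinearMap.map_smul_of_tower, Finset.sum_neg_distrib, Finset.smul_sum]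

end Fibration

end AdiabaticDirac

end

/-! ### The matrix form of δ_t -/

theorem mainTheorem11 {n : ℕ} {N : Type u} [TopologicalSpace N] [T2Space N] [CompactSpace N]
    [ChartedSpace (EuclideanSpace ℝ (Fin (2 * n + 1))) N] [IsManifold (𝓡 (2 * n + 1)) ∞ N]
    (X : AdiabaticDirac.Fibration n N) (P : AdiabaticDirac.Fibration.FiberSpin.{u, w} X)
    {Sg : Type v} [NormedAddCommGroup Sg] [InnerProductSpace ℂ Sg]
    (R : AdiabaticDirac.SpinorModule n Sg) (dth : X.UnitField) (t : ℝ) (ht : 0 < t) :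
    ∃ Dstar : (P.index → N → Sg) → P.index → N → Sg,
      X.IsFormalAdjoint P R (X.metric t) (X.fiberDirac P R) Dstar ∧
      ∀ φp φm : P.index → N → Sg, X.IsPosSpinor P R φp → X.IsNegSpinor P R φm →
        ∀ a, ∀ x ∈ P.dom a,
          R.projPlus (X.delta P R dth t ht (φp + φm) a x)
            = -((t : ℂ) * Complex.I) • X.nablaTilde P R dth.field φp a x + Dstar φm a x ∧
          R.projMinus (X.delta P R dth t ht (φp + φm) a x)
            = X.fiberDirac P R φp a x
              + ((t : ℂ) * Complex.I) • X.nablaTilde P R dth.field φm a x := by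
  -- The fiber Dirac operator acts on all of S; its restriction to S^- is the adjoint of its
  -- restriction to S^+.
  refine ⟨X.fiberDirac P R, X.isFormalAdjoint_fiberDirac P R dth ht, ?_⟩
  intro φp φm hp hm a x hx
  have hp1 : ∀ y ∈ P.dom a, R.chir (φp a y) = (1 : ℝ) • φp a y := fun y hy => by
    rw [one_smul]; exact hp.2 a y hy
  have hm1 : ∀ y ∈ P.dom a, R.chir (φm a y) = (-1 : ℝ) • φm a y := fun y hy => by
    rw [neg_one_smul]; exact hm.2 a y hy
  have e1 := X.chir_nablaTilde P R hp.1 a hx hp1 dth.field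
  have e2 := X.chir_nablaTilde P R hm.1 a hx hm1 dth.field
  have e3 := X.chir_fiberDirac P R hp.1 a hx hp1
  have e4 := X.chir_fiberDirac P R hm.1 a hx hm1
  rw [one_smul] at e1 e3
  rw [neg_one_smul] at e2 e4
  rw [X.delta_eq P R dth ht _ a hx, X.fiberDirac_add P R hp.1 a hx hm.1,
    X.nablaTilde_add P R hp.1 a hx hm.1]
  simp only [AdiabaticDirac.SpinorModule.projPlus, AdiabaticDirac.SpinorModule.projMinus,
    ← Complex.coe_smul, map_add, map_smul, LinearMap.smul_apply, e1, e2, e3, e4, map_neg, neg_neg]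
  -- Every term is now an eigenvector of chirality, so the projections reduce to linear identities
  -- with complex coefficients.
  constructor <;> module
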